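/- Let $K$ be a field, let $W$ be a finite-dimensional symplectic vector space over $K$ (that is, $W$ carries a non-degenerate alternating bilinear form $\langle\cdot,\cdot\rangle$), and let $G=(V,E)$ be a finite simple graph with maximal degree $D$. Let $d\ge 0$ be an integer such that $G$ is $d$-degenerate, i.e. the vertices of $G$ can be linearly ordered so that every vertex has at most $d$ neighbours that are greater than itself. Let $\widetilde X(G,W)$ be the projective graph variety: the closed subscheme of $\mathbb P(W)^V$ (the product over $\operatorname{Spec}K$, where $\mathbb P(W)$ is the projective space of lines in $W$) defined by the equations $\langle w(v),w(u)\rangle=0$ for all edges $\{v,u\}\in E$. If $\dim W\ge d+D-1$, then $\widetilde X(G,W)$ is smooth over $K$ if and only if $G$ is a forest. -/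

import Mathlib

open CategoryTheory CategoryTheory.Limits AlgebraicGeometry

universe u

noncomputable section

/-- A finite graph is `d`-degenerate if its vertices can be linearly ordered so that every vertex
has at most `d` neighbours greater than itself. -/
def SimpleGraph.IsDegenerate {V : Type*} (G : SimpleGraph V) (d : ℕ) : Prop :=
  ∃ _ : LinearOrder V, ∀ v : V, {w : V | v < w ∧ G.Adj v w}.ncard ≤ d

namespace GraphVariety

section ProjectiveSpace

variable (K : Type u) [Field K] (n : ℕ)

/-- The homogeneous coordinate ring `K[x₀, …, x₍ₙ₋₁₎]`, graded by degree. -/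
abbrev grading : ℕ → Submodule K (MvPolynomial (Fin n) K) :=
  MvPolynomial.homogeneousSubmodule (Fin n) K

instance : GradedAlgebra (grading K n) := MvPolynomial.gradedAlgebra

/-- The projective space of lines in `K ^ n`, as a scheme over `Spec K`. -/
def projectiveSpace : Over (Spec (CommRingCat.of K)) :=
  Over.mk (Proj.toSpecZero (grading K n) ≫
    Spec.map (CommRingCat.ofHom (algebraMap K (grading K n 0))))

/-- The standard open subset `xᵢ ≠ 0` of the projective space. -/
def chart (i : Fin n) : (projectiveSpace K n).left.Opens :=
  Proj.basicOpen (grading K n) (MvPolynomial.X i)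

variable {K n}

/-- The linear form `∑ₐ cₐ xₐ`. -/
def linearForm (c : Fin n → K) : MvPolynomial (Fin n) K :=
  ∑ a, MvPolynomial.C (c a) * MvPolynomial.X a

theorem linearForm_mem (c : Fin n → K) : linearForm c ∈ grading K n (1 • 1) := by
  rw [MvPolynomial.mem_homogeneousSubmodule]
  refine MvPolynomial.IsHomogeneous.sum _ _ _ fun a _ => ?_
  simpa using (MvPolynomial.isHomogeneous_C (Fin n) (c a)).mul (MvPolynomial.isHomogeneous_X K a)

/-- The regular function `(∑ₐ cₐ xₐ) / xᵢ` on the standard open subset `xᵢ ≠ 0`. -/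
def fraction (i : Fin n) (c : Fin n → K) : Γ((projectiveSpace K n).left, chart K n i) :=
  Proj.awayToSection (grading K n) (MvPolynomial.X i)
    (HomogeneousLocalization.Away.mk (grading K n) (d := 1) (MvPolynomial.isHomogeneous_X K i) 1
      (linearForm c) (linearForm_mem c))

end ProjectiveSpace

variable {K : Type u} [Field K] {V : Type*} [Finite V] {W : Type*} [AddCommGroup W] [Module K W]
  {n : ℕ}

variable (K V n) in
/-- The product over `Spec K` of copies, indexed by `V`, of the projective space. -/
def multiProjectiveSpace : Over (Spec (CommRingCat.of K)) :=
  ∏ᶜ fun _ : V => projectiveSpace K n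

variable (K n) in
/-- The projection of the product to the factor with index `v`. -/
def proj (v : V) : (multiProjectiveSpace K V n).left ⟶ (projectiveSpace K n).left :=
  (Pi.π (fun _ : V => projectiveSpace K n) v).left

/-- The local equation `⟨w(v), w(v')⟩ = 0`. In the coordinates of `W` given by the basis `b`, this is
the regular function `∑ₐ (xₐ / xᵢ)(w(v)) * ((∑ₑ ⟨bₐ, bₑ⟩ xₑ) / xⱼ)(w(v'))` on an open set `T` on which
the `i`-th coordinate of `w(v)` and the `j`-th coordinate of `w(v')` do not vanish. -/
def equation (B : LinearMap.BilinForm K W) (b : Module.Basis (Fin n) K W) (v v' : V) (i j : Fin n)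
    (T : (multiProjectiveSpace K V n).left.Opens)
    (hi : T ≤ (proj K n v) ⁻¹ᵁ (chart K n i)) (hj : T ≤ (proj K n v') ⁻¹ᵁ (chart K n j)) :
    Γ((multiProjectiveSpace K V n).left, T) :=
  ∑ a : Fin n,
    (proj K n v).appLE (chart K n i) T hi (fraction i (Pi.single a 1)) *
      (proj K n v').appLE (chart K n j) T hj (fraction j fun e => B (b a) (b e))

/-- The ideal sheaf generated by the equations `⟨w(v), w(v')⟩ = 0` for all edges `{v, v'}`: the
smallest quasi-coherent ideal sheaf that contains all the local equations. -/
def graphIdeal (G : SimpleGraph V) (B : LinearMap.BilinForm K W) (b : Module.Basis (Fin n) K W) :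
    (multiProjectiveSpace K V n).left.IdealSheafData :=
  sInf {J | ∀ v v' : V, G.Adj v v' → ∀ (i j : Fin n)
    (T : (multiProjectiveSpace K V n).left.affineOpens)
    (hi : T.1 ≤ (proj K n v) ⁻¹ᵁ (chart K n i)) (hj : T.1 ≤ (proj K n v') ⁻¹ᵁ (chart K n j)),
      equation B b v v' i j T.1 hi hj ∈ J.ideal T}

/-- The projective graph variety: the closed subscheme of the product of copies of the projective
space of lines in `W`, one for each vertex, that is defined by the equations `⟨w(v), w(v')⟩ = 0` for
all edges `{v, v'}`; as a scheme over `Spec K`. The basis `b` identifies `W` with `K ^ n`. -/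
def projectiveGraphVariety (G : SimpleGraph V) (B : LinearMap.BilinForm K W)
    (b : Module.Basis (Fin n) K W) : Over (Spec (CommRingCat.of K)) :=
  Over.mk ((graphIdeal G B b).subschemeι ≫ (multiProjectiveSpace K V n).hom)

end GraphVariety

end

/-! ### Finite products over a base -/

noncomputable section

/-! The variety is locally of finite type over a field, so smoothness amounts to the infinitesimal
lifting property on affine pieces. This is tested on points with values in a `K`-algebra: such a
point inside a product of standard charts is a family of coordinate vectors `w v` with one
coordinate equal to `1`, and it lies on the variety exactly when `pairing B b (w v) (w v') = 0` for
every edge. Smoothness thus becomes the question whether solutions of these bilinear equations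
modulo a square-zero ideal lift.

For a forest they always lift (`exists_lift_of_isAcyclic`). Remove a leaf, lift the rest, then
repair the single equation at the leaf by adding a multiple of a vector that pairs to `1` with the
coordinates of its neighbour; nondegeneracy supplies that vector.

If there is a cycle, take all lines equal, which is a solution because the form is alternating, and
perturb to first order in `K[[t]]/(t ^ 3)`, with perturbations pairing to `1` along one edge `pq` of
the cycle and to `0` along all other edges. The equations then hold modulo `t ^ 2`. For any lift,
the second-order terms form a function on vertices whose differences along edges must cancel the
pairings of the perturbations; going round the cycle yields `t ^ 2 = 0`, a contradiction
(`exists_not_liftable`). This needs dimension at least `3`. A cycle forces both `d` and the maximal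
degree to be at least `2`, so the dimension bound gives it. -/

/-- A product in `Over S` is an iterated fibre product: each new factor is a base change followed by
a composition, starting from the identity of `S`. -/
theorem GraphVariety.exists_fan_over {C : Type*} [Category C] [HasPullbacks C]
    (P : MorphismProperty C) [P.IsMultiplicative] [P.IsStableUnderBaseChange] {S : C} :
    ∀ {m : ℕ} (f : Fin m → Over S), (∀ i, P (f i).hom) →
      ∃ (c : Fan f) (_ : IsLimit c), P c.pt.hom := by
  intro m
  induction m with
  | zero =>
    intro f _
    refine ⟨Fan.mk (Over.mk (𝟙 S)) fun i => i.elim0, Fan.IsLimit.mk _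
      (fun s => Over.mkIdTerminal.from s.pt) (fun _ i => i.elim0)
      (fun _ _ _ => Over.mkIdTerminal.hom_ext _ _), P.id_mem S⟩
  | succ m ih =>
    intro f hf
    obtain ⟨c, hc, hP⟩ := ih (fun i => f i.succ) fun i => hf i.succ
    let p := pullbackIsPullback (f 0).hom c.pt.hom
    let q := IsLimit.pullbackConeEquivBinaryFanFunctor p
    exact ⟨extendFan c _, extendFanIsLimit f hc q,
      P.comp_mem _ _ (P.pullback_fst _ _ hP) (hf 0)⟩

theorem GraphVariety.pi_over {C : Type*} [Category C] [HasPullbacks C]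
    (P : MorphismProperty C) [P.IsMultiplicative] [P.IsStableUnderBaseChange] {S : C}
    {V : Type*} [Finite V] (f : V → Over S) [HasProduct f] (hf : ∀ v, P (f v).hom) :
    P (∏ᶜ f).hom := by
  obtain ⟨m, ⟨e⟩⟩ := Finite.exists_equiv_fin V
  obtain ⟨c, hc, hP⟩ := exists_fan_over P (fun i => f (e.symm i)) fun i => hf _
  have : HasProduct (f ∘ e.symm) := ⟨⟨c, hc⟩⟩
  have : HasLimit (Discrete.functor fun i => f (e.symm i)) := this
  let i : ∏ᶜ f ≅ c.pt := (Pi.reindex e.symm f).symm ≪≫ limit.isoLimitCone ⟨c, hc⟩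
  exact (P.arrow_mk_iso_iff (Arrow.isoMk ((Over.forget S).mapIso i) (Iso.refl _) (by simp))).2 hP

/-! ### Projective space is separated and locally of finite type -/

namespace GraphVariety

variable {K : Type u} [Field K] {n : ℕ}

/-- Forms of degree zero are constants, so `Proj.toSpecZero` is the structure map over `K` up to an
isomorphism. -/
theorem algebraMap_grading_zero_bijective :
    Function.Bijective (algebraMap K (grading K n 0)) := by
  constructor
  · intro a b h
    have := congrArg Subtype.val h
    exact MvPolynomial.C_injective _ _ this
  · intro x
    obtain ⟨p, hp⟩ := x
    have := (MvPolynomial.mem_homogeneousSubmodule _ _).1 hp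
    refine ⟨p.coeff 0, Subtype.ext ?_⟩
    exact (MvPolynomial.totalDegree_eq_zero_iff_eq_C.1 ((MvPolynomial.totalDegree_zero_iff_isHomogeneous _).2 this)).symm

instance : IsIso (CommRingCat.ofHom (algebraMap K (grading K n 0))) :=
  (ConcreteCategory.isIso_iff_bijective _).2 algebraMap_grading_zero_bijective

instance : Algebra.FiniteType (grading K n 0) (MvPolynomial (Fin n) K) :=
  have : IsScalarTower K (grading K n 0) (MvPolynomial (Fin n) K) :=
    IsScalarTower.of_algebraMap_eq (R := K) (S := grading K n 0) fun _ => rfl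
  .of_restrictScalars_finiteType K _ _

variable (K n) in
theorem projectiveSpace_locallyOfFiniteType : LocallyOfFiniteType (projectiveSpace K n).hom := by
  unfold projectiveSpace
  dsimp
  infer_instance

variable (K n) in
theorem projectiveSpace_isSeparated : IsSeparated (projectiveSpace K n).hom := by
  unfold projectiveSpace
  dsimp
  infer_instance

variable (V : Type*) [Finite V]

instance : LocallyOfFiniteType (multiProjectiveSpace K V n).hom :=
  pi_over @LocallyOfFiniteType _ fun _ => projectiveSpace_locallyOfFiniteType K n

instance : IsSeparated (multiProjectiveSpace K V n).hom :=
  pi_over @IsSeparated _ fun _ => projectiveSpace_isSeparated K n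

end GraphVariety

/-! ### Points of projective space with values in a `K`-algebra -/

namespace GraphVariety

open MvPolynomial HomogeneousLocalization

/-- The value of a section on an `A`-valued point. -/
def evalSection {A : Type u} [CommRing A] {Y : Scheme.{u}} (g : Spec (.of A) ⟶ Y) (T : Y.Opens)
    (h : ⊤ ≤ g ⁻¹ᵁ T) : Γ(Y, T) →+* A :=
  (g.appLE T ⊤ h ≫ (Scheme.ΓSpecIso (.of A)).hom).hom

theorem evalSection_SpecMap {A B : Type u} [CommRing A] [CommRing B] {Y : Scheme.{u}} (φ : A →+* B)
    (g : Spec (.of A) ⟶ Y) (T : Y.Opens) (h : ⊤ ≤ g ⁻¹ᵁ T)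
    (h' : ⊤ ≤ (Spec.map (CommRingCat.ofHom φ) ≫ g) ⁻¹ᵁ T) (s : Γ(Y, T)) :
    evalSection (Spec.map (CommRingCat.ofHom φ) ≫ g) T h' s = φ (evalSection g T h s) := by
  have : (Spec.map (CommRingCat.ofHom φ) ≫ g).appLE T ⊤ h' ≫ (Scheme.ΓSpecIso (.of B)).hom =
      (g.appLE T ⊤ h ≫ (Scheme.ΓSpecIso (.of A)).hom) ≫ CommRingCat.ofHom φ := by
    rw [Category.assoc, ← Scheme.ΓSpecIso_naturality, ← Category.assoc,
      ← Scheme.Hom.appLE_comp_appLE _ _ T ⊤ ⊤ h le_top]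
    rw [show (Spec.map (CommRingCat.ofHom φ)).appLE ⊤ ⊤ le_top = (Spec.map (CommRingCat.ofHom φ)).appTop
      from Scheme.Hom.appLE_eq_app _, Category.assoc]
  exact congr($(this).hom s)

theorem evalSection_appLE {A : Type u} [CommRing A] {Y Z : Scheme.{u}}
    (g : Spec (.of A) ⟶ Y) (f : Y ⟶ Z) (T : Y.Opens) (U : Z.Opens) (h : ⊤ ≤ g ⁻¹ᵁ T)
    (h' : T ≤ f ⁻¹ᵁ U) (h'' : ⊤ ≤ (g ≫ f) ⁻¹ᵁ U) (s : Γ(Z, U)) :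
    evalSection g T h (f.appLE U T h' s) = evalSection (g ≫ f) U h'' s := by
  unfold evalSection
  rw [← Scheme.Hom.appLE_comp_appLE _ _ U T ⊤ h' h]
  rfl

variable {K : Type u} [Field K] {n : ℕ} {A B : Type u} [CommRing A] [Algebra K A] [CommRing B]
  [Algebra K B]

/-- Evaluation of degree zero fractions at a vector of coordinates. -/
def evalAway (f : MvPolynomial (Fin n) K) (w : Fin n → A) (hu : IsUnit (aeval w f)) :
    Away (grading K n) f →+* A :=
  (IsLocalization.Away.lift (S := Localization.Away f) f
    (g := (aeval w : MvPolynomial (Fin n) K →ₐ[K] A).toRingHom) hu).comp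
    (algebraMap (Away (grading K n) f) (Localization.Away f))

theorem evalAway_mk {m : ℕ} {f : MvPolynomial (Fin n) K} (hf : f ∈ grading K n m) (w : Fin n → A)
    (hu : IsUnit (aeval w f)) (k : ℕ) (x : MvPolynomial (Fin n) K) (hx : x ∈ grading K n (k • m)) :
    evalAway f w hu (Away.mk (grading K n) hf k x hx) * aeval w f ^ k = aeval w x := by
  have h1 : (algebraMap (Away (grading K n) f) (Localization.Away f))
      (Away.mk (grading K n) hf k x hx) * algebraMap _ (Localization.Away f) (f ^ k) =
      algebraMap _ (Localization.Away f) x := by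
    rw [HomogeneousLocalization.algebraMap_apply, Away.val_mk, Localization.mk_eq_mk']
    exact IsLocalization.mk'_spec _ _ _
  have := congrArg (IsLocalization.Away.lift (S := Localization.Away f) f
    (g := (aeval w : MvPolynomial (Fin n) K →ₐ[K] A).toRingHom) hu) h1
  simpa [evalAway] using this

/-- The form becomes a unit, so the value of a fraction is determined by its numerator and
denominator. -/
theorem ringHom_away_ext {m : ℕ} {f : MvPolynomial (Fin n) K} (hf : f ∈ grading K n m)
    (w : Fin n → A) (hu : IsUnit (aeval w f)) (φ : Away (grading K n) f →+* A)
    (h : ∀ k x hx, φ (Away.mk (grading K n) hf k x hx) * aeval w f ^ k = aeval w x) :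
    φ = evalAway f w hu := by
  ext y
  obtain ⟨k, x, hx, rfl⟩ := Away.mk_surjective _ hf y
  have := (h k x hx).trans (evalAway_mk hf w hu k x hx).symm
  exact (hu.pow k).mul_left_injective this

/-- The open immersion of the complement of the zero locus of a form into the projective space. -/
def awayι {m : ℕ} {f : MvPolynomial (Fin n) K} (hf : f ∈ grading K n m) (hm : 0 < m) :
    Spec (.of (Away (grading K n) f)) ⟶ (projectiveSpace K n).left :=
  Proj.awayι (grading K n) f hf hm

instance {m : ℕ} {f : MvPolynomial (Fin n) K} (hf : f ∈ grading K n m) (hm : 0 < m) :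
    IsOpenImmersion (awayι hf hm) :=
  inferInstanceAs (IsOpenImmersion (Proj.awayι (grading K n) f hf hm))

theorem SpecMap_awayMap_awayι {m m' : ℕ} {f g x : MvPolynomial (Fin n) K} (hf : f ∈ grading K n m)
    (hm : 0 < m) (hg : g ∈ grading K n m') (hx : x = f * g) (hx' : x ∈ grading K n (m + m')) :
    Spec.map (CommRingCat.ofHom (awayMap (grading K n) hg hx)) ≫ awayι hf hm =
      awayι hx' (by omega) :=
  Proj.SpecMap_awayMap_awayι (grading K n) hf hm hg hx

/-- The `A`-valued point of the projective space with a given vector of coordinates on which the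
form `f` is invertible. -/
def pointOfForm {m : ℕ} {f : MvPolynomial (Fin n) K} (hf : f ∈ grading K n m) (hm : 0 < m)
    (w : Fin n → A) (hu : IsUnit (aeval w f)) : Spec (.of A) ⟶ (projectiveSpace K n).left :=
  Spec.map (CommRingCat.ofHom (evalAway f w hu)) ≫ awayι hf hm

/-- Shrinking the chart does not change the point. This allows charts to be compared on their
overlap. -/
theorem pointOfForm_mul {m m' : ℕ} {f g x : MvPolynomial (Fin n) K} (hf : f ∈ grading K n m)
    (hm : 0 < m) (hg : g ∈ grading K n m') (hx : x = f * g) (hx' : x ∈ grading K n (m + m'))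
    (w : Fin n → A) (hu : IsUnit (aeval w f)) (hu' : IsUnit (aeval w x)) :
    pointOfForm hx' (by omega) w hu' = pointOfForm hf hm w hu := by
  unfold pointOfForm
  rw [← SpecMap_awayMap_awayι hf hm hg hx hx', ← Category.assoc, ← Spec.map_comp,
    ← CommRingCat.ofHom_comp]
  congr 3
  refine ringHom_away_ext hf w hu _ fun k y hy => ?_
  rw [RingHom.comp_apply, awayMap_mk]
  have hg' : IsUnit (aeval w g) := by
    rw [hx, map_mul] at hu'
    exact isUnit_of_mul_isUnit_right hu'
  apply (hg'.pow k).mul_left_injective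
  have := evalAway_mk hx' w hu' k (y * g ^ k)
    (by rw [smul_add]; exact SetLike.mul_mem_graded hy (SetLike.pow_mem_graded k hg))
  simp only [← map_pow, ← map_mul] at this ⊢
  have e : x ^ k = (f * g) ^ k := by rw [hx]
  rw [← this, mul_assoc, ← map_mul, ← mul_pow, e]

theorem X_mem (i : Fin n) : (X i : MvPolynomial (Fin n) K) ∈ grading K n 1 :=
  isHomogeneous_X K i

variable (K) in
/-- The `A`-valued point of the projective space with a given vector of coordinates whose `i`-th
coordinate is invertible. -/
def point (w : Fin n → A) (i : Fin n) (hu : IsUnit (w i)) :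
    Spec (.of A) ⟶ (projectiveSpace K n).left :=
  pointOfForm (X_mem i) one_pos w (by rwa [aeval_X])

theorem point_eq_point (w : Fin n → A) (i j : Fin n) (hi : IsUnit (w i)) (hj : IsUnit (w j)) :
    point K w i hi = point K w j hj := by
  -- Both points factor through the common chart where `X i * X j` is invertible.
  have hu : IsUnit (aeval w (X i * X j : MvPolynomial (Fin n) K)) := by
    simpa using ⟨hi, hj⟩
  rw [point, point, ← pointOfForm_mul (X_mem i) one_pos (X_mem j) rfl
    (SetLike.mul_mem_graded (X_mem i) (X_mem j)) w _ hu,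
    ← pointOfForm_mul (X_mem j) one_pos (X_mem i) (mul_comm _ _)
    (SetLike.mul_mem_graded (X_mem i) (X_mem j)) w _ hu]

theorem SpecMap_point (φ : A →ₐ[K] B) (w : Fin n → A) (i : Fin n) (hi : IsUnit (w i))
    (hi' : IsUnit (φ (w i))) :
    Spec.map (CommRingCat.ofHom φ.toRingHom) ≫ point K w i hi =
      point K (fun a => φ (w a)) i hi' := by
  unfold point pointOfForm
  rw [← Category.assoc, ← Spec.map_comp, ← CommRingCat.ofHom_comp]
  congr 3
  refine ringHom_away_ext (X_mem i) _ _ _ fun k y hy => ?_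
  have := congrArg φ (evalAway_mk (X_mem i) w (by rwa [aeval_X]) k y hy)
  rw [map_mul, map_pow] at this
  have e (p : MvPolynomial (Fin n) K) : aeval (fun a => φ (w a)) p = φ (aeval w p) := by
    rw [← AlgHom.comp_apply, comp_aeval]
  rw [e, e, ← this]
  rfl

omit [Algebra K A] in
theorem SpecMap_awayι_comp_hom {m : ℕ} {f : MvPolynomial (Fin n) K} (hf : f ∈ grading K n m)
    (hm : 0 < m) (φ : Away (grading K n) f →+* A) :
    (Spec.map (CommRingCat.ofHom φ) ≫ awayι hf hm) ≫
      (projectiveSpace K n).hom =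
      Spec.map (CommRingCat.ofHom (φ.comp ((fromZeroRingHom (grading K n) _).comp
        (algebraMap K (grading K n 0))))) := by
  dsimp [projectiveSpace, awayι]
  rw [Category.assoc, Proj.awayι_toSpecZero_assoc, ← Spec.map_comp, ← Spec.map_comp]

theorem fromZeroRingHom_eq_mk {m : ℕ} {f : MvPolynomial (Fin n) K} (hf : f ∈ grading K n m) (c : K) :
    fromZeroRingHom (grading K n) (Submonoid.powers f) (algebraMap K (grading K n 0) c) =
      Away.mk (grading K n) hf 0 (C c) (by simp) := by
  ext
  simp [fromZeroRingHom]
  rfl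

theorem point_comp_hom (w : Fin n → A) (i : Fin n) (hi : IsUnit (w i)) :
    point K w i hi ≫ (projectiveSpace K n).hom =
      Spec.map (CommRingCat.ofHom (algebraMap K A)) := by
  unfold point pointOfForm
  rw [SpecMap_awayι_comp_hom]
  congr 2
  ext c
  have := evalAway_mk (X_mem i) w (by rwa [aeval_X]) 0 (C c)
    (by simp)
  simp only [RingHom.comp_apply, fromZeroRingHom_eq_mk (X_mem (K := K) i)]
  simpa using this

theorem evalSection_congr {A : Type u} [CommRing A] {Y : Scheme.{u}} {g g' : Spec (.of A) ⟶ Y}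
    (e : g = g') (T : Y.Opens) (h : ⊤ ≤ g ⁻¹ᵁ T) (s : Γ(Y, T)) :
    evalSection g T h s = evalSection g' T (e ▸ h) s := by
  subst e; rfl

theorem awayToSection_awayι_appLE {m : ℕ} {f : MvPolynomial (Fin n) K} (hf : f ∈ grading K n m)
    (hm : 0 < m) (h) :
    Proj.awayToSection (grading K n) f ≫ (Proj.awayι (grading K n) f hf hm).appLE
      (Proj.basicOpen (grading K n) f) ⊤ h = (Scheme.ΓSpecIso _).inv := by
  have h1 := Proj.basicOpenToSpec_app_top (grading K n) f
  rw [← Proj.basicOpenIsoSpec_hom (grading K n) f hf hm] at h1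
  change (Proj.basicOpenIsoSpec (grading K n) f hf hm).hom.appTop = _ at h1
  have h2 : (Proj.awayι (grading K n) f hf hm).appLE (Proj.basicOpen (grading K n) f) ⊤ h =
      (Proj.basicOpen (grading K n) f).topIso.inv ≫
        (Proj.basicOpenIsoSpec (grading K n) f hf hm).inv.appTop := by
    change ((Proj.basicOpenIsoSpec (grading K n) f hf hm).inv ≫
      (Proj.basicOpen (grading K n) f).ι).appLE _ _ _ = _
    rw [← Scheme.Hom.appLE_comp_appLE _ _ (Proj.basicOpen (grading K n) f) ⊤ ⊤ (by simp) le_top]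
    congr 1
  have h3 : (Proj.basicOpenIsoSpec (grading K n) f hf hm).hom.appTop ≫
      (Proj.basicOpenIsoSpec (grading K n) f hf hm).inv.appTop = 𝟙 _ := by
    rw [← Scheme.Hom.comp_appTop]; simp
  rw [h2, ← cancel_epi (Scheme.ΓSpecIso _).hom, Iso.hom_inv_id, ← h3, h1]
  simp only [Category.assoc]

theorem evalSection_awayι {m : ℕ} {f : MvPolynomial (Fin n) K} (hf : f ∈ grading K n m)
    (hm : 0 < m) (h) (s : Away (grading K n) f) :
    evalSection (awayι hf hm) (Proj.basicOpen (grading K n) f) h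
      (Proj.awayToSection (grading K n) f s) = s := by
  have h1 := congr($(awayToSection_awayι_appLE hf hm h).hom s)
  have h2 := congr($((Scheme.ΓSpecIso (.of (Away (grading K n) f))).inv_hom_id).hom s)
  exact (congrArg (Scheme.ΓSpecIso (.of (Away (grading K n) f))).hom.hom h1).trans h2

theorem chart_le_preimage_awayι (i : Fin n) :
    ⊤ ≤ awayι (X_mem (K := K) i) one_pos ⁻¹ᵁ chart K n i := by
  intro x _
  change awayι (X_mem (K := K) i) one_pos x ∈ Proj.basicOpen (grading K n) (X i)
  rw [← Proj.opensRange_awayι (grading K n) (X i) (X_mem (K := K) i) one_pos]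
  exact ⟨x, rfl⟩

theorem point_eq (w : Fin n → A) (i : Fin n) (hi : IsUnit (w i)) :
    point K w i hi = Spec.map (CommRingCat.ofHom (evalAway (X i) w (by rwa [aeval_X]))) ≫
      awayι (X_mem i) one_pos := rfl

theorem chart_le_preimage_point (w : Fin n → A) (i : Fin n) (hi : IsUnit (w i)) :
    ⊤ ≤ point K w i hi ⁻¹ᵁ chart K n i := by
  rw [point_eq, Scheme.Hom.comp_preimage, top_le_iff.1 (chart_le_preimage_awayι i),
    Scheme.Hom.preimage_top]

theorem evalSection_awayι_fraction (i : Fin n) (c : Fin n → K) :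
    evalSection (awayι (X_mem i) one_pos) (chart K n i) (chart_le_preimage_awayι i) (fraction i c) =
      Away.mk (grading K n) (X_mem i) 1 (linearForm c) (linearForm_mem c) :=
  evalSection_awayι (X_mem (K := K) i) one_pos (chart_le_preimage_awayι i) _

theorem evalSection_point (w : Fin n → A) (i : Fin n) (hi : IsUnit (w i)) (h) (c : Fin n → K) :
    evalSection (point K w i hi) (chart K n i) h (fraction i c) * w i =
      ∑ a, algebraMap K A (c a) * w a := by
  rw [evalSection_congr (point_eq w i hi),
    evalSection_SpecMap _ _ _ (chart_le_preimage_awayι i), evalSection_awayι_fraction]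
  have := evalAway_mk (X_mem (K := K) i) w (by rwa [aeval_X]) 1 _ (linearForm_mem c)
  simpa [linearForm] using this

theorem awayι_preimage_chart (i j : Fin n) :
    awayι (X_mem i) one_pos ⁻¹ᵁ chart K n j =
      PrimeSpectrum.basicOpen (Away.isLocalizationElem (X_mem (K := K) i) (X_mem j)) :=
  Proj.awayι_preimage_basicOpen (grading K n) (X_mem i) one_pos (X_mem j) one_pos

theorem isUnit_of_le_preimage_point (w : Fin n → A) (i j : Fin n) (hi : IsUnit (w i))
    (h : ⊤ ≤ point K w i hi ⁻¹ᵁ chart K n j) : IsUnit (w j) := by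
  have h2 : IsUnit (evalAway (X i) w (by rwa [aeval_X])
      (Away.isLocalizationElem (X_mem (K := K) i) (X_mem j))) := by
    rw [point_eq, Scheme.Hom.comp_preimage, awayι_preimage_chart] at h
    by_contra hn
    -- A maximal ideal containing `w j / w i` is a point of `Spec A` sent outside the `j`-th chart.
    obtain ⟨m, hm, hmem⟩ := exists_max_ideal_of_mem_nonunits hn
    exact h (x := (⟨m, hm.isPrime⟩ : PrimeSpectrum A)) trivial hmem
  have h1 := evalAway_mk (X_mem (K := K) i) w (by rwa [aeval_X]) 1 (X j ^ 1)
    (by simpa using X_mem j)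
  have h3 : aeval w (X j ^ 1 : MvPolynomial (Fin n) K) = w j := by simp
  rw [← h3, ← h1]
  exact h2.mul (by simpa using hi)

theorem eval₂_mul_of_isHomogeneous {R : Type*} [CommRing R] (ρ : K →+* R) (u : Fin n → R) (c : R)
    {x : MvPolynomial (Fin n) K} {k : ℕ} (hx : x.IsHomogeneous k) :
    eval₂ ρ (fun a => u a * c) x = eval₂ ρ u x * c ^ k := by
  rw [eval₂_eq', eval₂_eq', Finset.sum_mul]
  refine Finset.sum_congr rfl fun d hd => ?_
  have : ∑ a, d a = k := by
    have := hx (mem_support_iff.1 hd)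
    rw [← this, Finsupp.weight_apply, Finsupp.sum_fintype _ _ (by simp)]
    simp
  simp_rw [mul_pow, Finset.prod_mul_distrib, Finset.prod_pow_eq_pow_sum, this, mul_assoc]

/-- Dehomogenization: a ring map out of the chart is determined by its values on constants and on
the ratios `X a / X i`. -/
theorem away_mk_eq_eval₂ (i : Fin n) (k : ℕ) (x : MvPolynomial (Fin n) K)
    (hx : x ∈ grading K n (k • 1)) :
    Away.mk (grading K n) (X_mem i) k x hx =
      eval₂ ((fromZeroRingHom (grading K n) (Submonoid.powers (X i))).comp
        (algebraMap K (grading K n 0)))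
        (fun a => Away.mk (grading K n) (X_mem i) 1 (X a) (X_mem a)) x := by
  apply HomogeneousLocalization.val_injective
  rw [← HomogeneousLocalization.algebraMap_apply, ← HomogeneousLocalization.algebraMap_apply,
    hom_eval₂]
  have hi := IsLocalization.Away.algebraMap_isUnit
    (S := Localization.Away (X i : MvPolynomial (Fin n) K)) (X i : MvPolynomial (Fin n) K)
  apply (hi.pow k).mul_left_injective
  have hx' : x.IsHomogeneous k := by simpa using hx
  dsimp only
  rw [← eval₂_mul_of_isHomogeneous _ _ _ hx']
  have spec (k : ℕ) (y : MvPolynomial (Fin n) K) (hy) :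
      algebraMap (Away (grading K n) (X i)) (Localization.Away (X i : MvPolynomial (Fin n) K))
      (Away.mk (grading K n) (X_mem i) k y hy) * algebraMap (MvPolynomial (Fin n) K) _ (X i) ^ k =
      algebraMap (MvPolynomial (Fin n) K) _ y := by
    rw [HomogeneousLocalization.algebraMap_apply, Away.val_mk, Localization.mk_eq_mk', ← map_pow]
    exact IsLocalization.mk'_spec _ _ _
  have spec1 (a) := spec 1 (X a) (X_mem a)
  simp only [pow_one] at spec1
  rw [spec]
  simp only [spec1]
  conv_lhs => rw [← eval₂_eta x, hom_eval₂]
  congr 1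

theorem exists_eq_point (g : Spec (.of A) ⟶ (projectiveSpace K n).left)
    (hg : g ≫ (projectiveSpace K n).hom = Spec.map (CommRingCat.ofHom (algebraMap K A)))
    (i : Fin n) (h : ⊤ ≤ g ⁻¹ᵁ chart K n i) :
    ∃ (w : Fin n → A) (hw : w i = 1), g = point K w i (hw ▸ isUnit_one) := by
  have hr : Set.range g ⊆ Set.range (awayι (X_mem (K := K) i) one_pos) := by
    rintro _ ⟨x, rfl⟩
    have : g x ∈ chart K n i := h (x := x) trivial
    have e : chart K n i = Proj.basicOpen (grading K n) (X i) := rfl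
    rw [e, ← Proj.opensRange_awayι (grading K n) (X i) (X_mem (K := K) i) one_pos] at this
    exact this
  obtain ⟨φ, hφ⟩ := Spec.map_surjective (IsOpenImmersion.lift (awayι (X_mem (K := K) i) one_pos) g hr)
  have hgφ : Spec.map φ ≫ awayι (X_mem (K := K) i) one_pos = g := by
    rw [hφ, IsOpenImmersion.lift_fac]
  obtain ⟨φ, rfl⟩ : ∃ ψ, φ = CommRingCat.ofHom ψ := ⟨φ.hom, rfl⟩
  rw [← hgφ, SpecMap_awayι_comp_hom] at hg
  have hK : φ.comp ((fromZeroRingHom (grading K n) _).comp (algebraMap K (grading K n 0))) =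
      algebraMap K A := congrArg CommRingCat.Hom.hom (Spec.map_injective hg)
  -- The coordinates are the values of the affine coordinates `X a / X i`.
  let w : Fin n → A := fun a => φ (Away.mk (grading K n) (X_mem i) 1 (X a) (X_mem a))
  have hw : w i = 1 := by
    rw [← map_one φ]
    refine congrArg φ (HomogeneousLocalization.val_injective _ ?_)
    rw [Away.val_mk, HomogeneousLocalization.val_one, Localization.mk_eq_mk']
    simp
  refine ⟨w, hw, ?_⟩
  rw [← hgφ]
  unfold point pointOfForm
  congr 3
  refine ringHom_away_ext (X_mem i) w _ φ fun k x hx => ?_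
  rw [aeval_X, hw, one_pow, mul_one, away_mk_eq_eval₂, hom_eval₂, hK]
  rfl

theorem point_injective (w w' : Fin n → A) (i : Fin n) (hw : w i = 1) (hw' : w' i = 1)
    (h : point K w i (hw ▸ isUnit_one) = point K w' i (hw' ▸ isUnit_one)) : w = w' := by
  classical
  ext a
  have hu : IsUnit (w i) := hw ▸ isUnit_one
  have hu' : IsUnit (w' i) := hw' ▸ isUnit_one
  have h1 := evalSection_point w i hu (chart_le_preimage_point (K := K) w i hu) (Pi.single a 1)
  have h2 := evalSection_point w' i hu' (chart_le_preimage_point (K := K) w' i hu') (Pi.single a 1)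
  rw [evalSection_congr h] at h1
  replace h1 := (congrArg _ (hw.trans hw'.symm).symm).trans h1
  replace h1 := h2.symm.trans h1
  simpa [Pi.single_apply] using h1.symm

end GraphVariety

/-! ### Points of the product and the equations evaluated on them -/

namespace GraphVariety

variable {K : Type u} [Field K] {n : ℕ} {V : Type*} [Finite V] {A R : Type u} [CommRing A]
  [Algebra K A] [CommRing R] [Algebra K R]

theorem multiProjectiveSpace_hom_ext {S : Scheme.{u}} {g g' : S ⟶ (multiProjectiveSpace K V n).left}
    (h : g ≫ (multiProjectiveSpace K V n).hom = g' ≫ (multiProjectiveSpace K V n).hom)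
    (hv : ∀ v, g ≫ proj K n v = g' ≫ proj K n v) : g = g' := by
  let X : Over (Spec (CommRingCat.of K)) := Over.mk (g ≫ (multiProjectiveSpace K V n).hom)
  let f : X ⟶ multiProjectiveSpace K V n := Over.homMk g rfl
  let f' : X ⟶ multiProjectiveSpace K V n := Over.homMk g' h.symm
  have : f = f' := Pi.hom_ext _ _ fun v => Over.OverMorphism.ext (hv v)
  exact congrArg CommaMorphism.left this

variable (K) in
/-- The `A`-valued point of the product of projective spaces with given vectors of coordinates. -/
def multiPoint (w : V → Fin n → A) (i : V → Fin n) (hu : ∀ v, IsUnit (w v (i v))) :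
    Spec (.of A) ⟶ (multiProjectiveSpace K V n).left :=
  (Pi.lift fun v => (Over.homMk (point K (w v) (i v) (hu v)) (point_comp_hom _ _ _) :
    Over.mk (Spec.map (CommRingCat.ofHom (algebraMap K A))) ⟶ projectiveSpace K n)).left

theorem multiPoint_proj (w : V → Fin n → A) (i : V → Fin n) (hu : ∀ v, IsUnit (w v (i v))) (v : V) :
    multiPoint K w i hu ≫ proj K n v = point K (w v) (i v) (hu v) := by
  exact congrArg CommaMorphism.left (Pi.lift_π (fun v =>
    (Over.homMk (point K (w v) (i v) (hu v)) (point_comp_hom _ _ _) :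
      Over.mk (Spec.map (CommRingCat.ofHom (algebraMap K A))) ⟶ projectiveSpace K n)) v)

theorem multiPoint_comp_hom (w : V → Fin n → A) (i : V → Fin n) (hu : ∀ v, IsUnit (w v (i v))) :
    multiPoint K w i hu ≫ (multiProjectiveSpace K V n).hom =
      Spec.map (CommRingCat.ofHom (algebraMap K A)) :=
  Over.w (Pi.lift fun v => (Over.homMk (point K (w v) (i v) (hu v)) (point_comp_hom _ _ _) :
    Over.mk (Spec.map (CommRingCat.ofHom (algebraMap K A))) ⟶ projectiveSpace K n))

theorem SpecMap_comp_algebraMap (φ : A →ₐ[K] R) :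
    Spec.map (CommRingCat.ofHom φ.toRingHom) ≫ Spec.map (CommRingCat.ofHom (algebraMap K A)) =
      Spec.map (CommRingCat.ofHom (algebraMap K R)) := by
  rw [← Spec.map_comp, ← CommRingCat.ofHom_comp]
  congr 2
  exact φ.comp_algebraMap

theorem SpecMap_multiPoint (φ : A →ₐ[K] R) (w : V → Fin n → A) (i : V → Fin n)
    (hu : ∀ v, IsUnit (w v (i v))) (hu' : ∀ v, IsUnit (φ (w v (i v)))) :
    Spec.map (CommRingCat.ofHom φ.toRingHom) ≫ multiPoint K w i hu =
      multiPoint K (fun v a => φ (w v a)) i hu' := by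
  apply multiProjectiveSpace_hom_ext
  · rw [Category.assoc, multiPoint_comp_hom, multiPoint_comp_hom, SpecMap_comp_algebraMap]
  · intro v
    rw [Category.assoc, multiPoint_proj, multiPoint_proj, SpecMap_point]

theorem exists_eq_multiPoint (g : Spec (.of A) ⟶ (multiProjectiveSpace K V n).left)
    (hg : g ≫ (multiProjectiveSpace K V n).hom = Spec.map (CommRingCat.ofHom (algebraMap K A)))
    (i : V → Fin n) (h : ∀ v, ⊤ ≤ g ⁻¹ᵁ (proj K n v ⁻¹ᵁ chart K n (i v))) :
    ∃ (w : V → Fin n → A) (hw : ∀ v, w v (i v) = 1),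
      g = multiPoint K w i fun v => hw v ▸ isUnit_one := by
  have hp (v : V) : proj K n v ≫ (projectiveSpace K n).hom = (multiProjectiveSpace K V n).hom :=
    Over.w (Pi.π (fun _ : V => projectiveSpace K n) v)
  choose w hw hwg using fun v => exists_eq_point (g ≫ proj K n v)
    (by rw [Category.assoc, hp, hg]) (i v) (h v)
  refine ⟨w, hw, multiProjectiveSpace_hom_ext ?_ fun v => ?_⟩
  · rw [hg, multiPoint_comp_hom]
  · rw [hwg, multiPoint_proj]

theorem multiPoint_injective (w w' : V → Fin n → A) (i : V → Fin n) (hw : ∀ v, w v (i v) = 1)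
    (hw' : ∀ v, w' v (i v) = 1)
    (h : multiPoint K w i (fun v => hw v ▸ isUnit_one) =
      multiPoint K w' i (fun v => hw' v ▸ isUnit_one)) : w = w' := by
  funext v
  refine point_injective (K := K) _ _ (i v) (hw v) (hw' v) ?_
  exact ((multiPoint_proj w i _ v).symm.trans (congrArg (· ≫ proj K n v) h)).trans
    (multiPoint_proj w' i _ v)

section Pairing

variable {W : Type*} [AddCommGroup W] [Module K W]

/-- The extension of scalars of a bilinear form, in coordinates. -/
def pairing (B : LinearMap.BilinForm K W) (b : Module.Basis (Fin n) K W) (x y : Fin n → A) : A :=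
  ∑ a, x a * ∑ e, algebraMap K A (B (b a) (b e)) * y e

variable (B : LinearMap.BilinForm K W) (b : Module.Basis (Fin n) K W)

theorem map_pairing (φ : A →ₐ[K] R) (x y : Fin n → A) :
    φ (pairing B b x y) = pairing B b (fun a => φ (x a)) fun a => φ (y a) := by
  simp [pairing]

/-- Clearing the two denominators turns the local equation into the pairing of coordinate vectors,
so its vanishing is independent of the charts used to write it. -/
theorem evalSection_equation (w : V → Fin n → A) (i : V → Fin n) (hu : ∀ v, IsUnit (w v (i v)))
    (v v' : V) (j j' : Fin n) (T : (multiProjectiveSpace K V n).left.Opens)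
    (h : ⊤ ≤ multiPoint K w i hu ⁻¹ᵁ T) (hj : T ≤ proj K n v ⁻¹ᵁ chart K n j)
    (hj' : T ≤ proj K n v' ⁻¹ᵁ chart K n j') :
    IsUnit (w v j) ∧ IsUnit (w v' j') ∧
      evalSection (multiPoint K w i hu) T h (equation B b v v' j j' T hj hj') *
        (w v j * w v' j') = pairing B b (w v) (w v') := by
  classical
  have aux (v : V) (j : Fin n) (hj : T ≤ proj K n v ⁻¹ᵁ chart K n j) :
      IsUnit (w v j) ∧ ∀ c, evalSection (multiPoint K w i hu) T h
        ((proj K n v).appLE (chart K n j) T hj (fraction j c)) * w v j =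
          ∑ a, algebraMap K A (c a) * w v a := by
    have h1 : ⊤ ≤ (multiPoint K w i hu ≫ proj K n v) ⁻¹ᵁ chart K n j := fun x hx => hj (h hx)
    have h2 := h1
    rw [multiPoint_proj] at h2
    have hun := isUnit_of_le_preimage_point _ _ _ _ h2
    refine ⟨hun, fun c => ?_⟩
    rw [evalSection_appLE _ _ _ _ _ _ h1, evalSection_congr
      ((multiPoint_proj w i hu v).trans (point_eq_point _ _ _ _ hun)), evalSection_point]
  obtain ⟨hv, hc⟩ := aux v j hj
  obtain ⟨hv', hc'⟩ := aux v' j' hj'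
  refine ⟨hv, hv', ?_⟩
  unfold equation pairing
  rw [map_sum, Finset.sum_mul]
  refine Finset.sum_congr rfl fun a _ => ?_
  rw [map_mul, mul_mul_mul_comm, hc, hc']
  simp [Pi.single_apply]

theorem evalSection_equation_eq_zero_iff (w : V → Fin n → A) (i : V → Fin n)
    (hu : ∀ v, IsUnit (w v (i v)))
    (v v' : V) (j j' : Fin n) (T : (multiProjectiveSpace K V n).left.Opens)
    (h : ⊤ ≤ multiPoint K w i hu ⁻¹ᵁ T) (hj : T ≤ proj K n v ⁻¹ᵁ chart K n j)
    (hj' : T ≤ proj K n v' ⁻¹ᵁ chart K n j') :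
    evalSection (multiPoint K w i hu) T h (equation B b v v' j j' T hj hj') = 0 ↔
      pairing B b (w v) (w v') = 0 := by
  obtain ⟨h1, h2, h3⟩ := evalSection_equation B b w i hu v v' j j' T h hj hj'
  rw [← h3, (h1.mul h2).mul_left_eq_zero]

end Pairing

theorem evalSection_fromSpec {Y : Scheme.{u}} {U : Y.Opens} (hU : IsAffineOpen U)
    (h : ⊤ ≤ hU.fromSpec ⁻¹ᵁ U) (s : Γ(Y, U)) :
    evalSection (A := Γ(Y, U)) hU.fromSpec U h s = s := by
  have : hU.fromSpec.appLE U ⊤ h ≫ (Scheme.ΓSpecIso Γ(Y, U)).hom = 𝟙 _ := by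
    rw [Scheme.Hom.appLE, hU.fromSpec_app_self, Category.assoc, Category.assoc, ← Functor.map_comp_assoc]
    simp
  exact congr($(this).hom s)

/-- The source is affine and the target is separated over `K`. Hence preimages of affine opens are
affine. -/
instance isAffineHom_multiPoint (w : V → Fin n → A) (i : V → Fin n)
    (hu : ∀ v, IsUnit (w v (i v))) : IsAffineHom (multiPoint K w i hu) := by
  have : IsAffineHom (multiPoint K w i hu ≫ (multiProjectiveSpace K V n).hom) := by
    rw [multiPoint_comp_hom]; infer_instance
  exact IsAffineHom.of_comp _ (multiProjectiveSpace K V n).hom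

/-! ### The ideal sheaf of the graph variety -/

section Ideal

variable {W : Type*} [AddCommGroup W] [Module K W]
  (B : LinearMap.BilinForm K W) (b : Module.Basis (Fin n) K W)

theorem equation_mem_ker (w : V → Fin n → A) (i : V → Fin n) (hu : ∀ v, IsUnit (w v (i v)))
    (v v' : V) (hw : pairing B b (w v) (w v') = 0) (j j' : Fin n)
    (T : (multiProjectiveSpace K V n).left.affineOpens)
    (hj : T.1 ≤ proj K n v ⁻¹ᵁ chart K n j) (hj' : T.1 ≤ proj K n v' ⁻¹ᵁ chart K n j') :
    equation B b v v' j j' T.1 hj hj' ∈ (multiPoint K w i hu).ker.ideal T := by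
  rw [Scheme.Hom.ker_apply, RingHom.mem_ker]
  -- The point need not land in `T`, so it is restricted to the affine preimage of `T`; there it is
  -- a point over a new algebra, with the mapped coordinates.
  have hT : IsAffineOpen (multiPoint K w i hu ⁻¹ᵁ T.1) := T.2.preimage _
  obtain ⟨ψ, hψ⟩ := Spec.map_surjective hT.fromSpec
  let R := Γ(Spec (.of A), multiPoint K w i hu ⁻¹ᵁ T.1)
  let _ : Algebra K R := (ψ.hom.comp (algebraMap K A)).toAlgebra
  let φ : A →ₐ[K] R := { ψ.hom with commutes' := fun _ => rfl }
  have hφ : hT.fromSpec = Spec.map (CommRingCat.ofHom φ.toRingHom) := hψ.symm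
  have htop : ⊤ ≤ hT.fromSpec ⁻¹ᵁ (multiPoint K w i hu ⁻¹ᵁ T.1) := by
    rw [hT.fromSpec_preimage_self]
  have e := SpecMap_multiPoint φ w i hu fun v => (hu v).map φ
  rw [← hφ] at e
  have h1 := (evalSection_equation_eq_zero_iff B b (fun v a => φ (w v a)) i
    (fun v => (hu v).map φ) v v' j j' T.1 (by rw [← e]; exact htop) hj hj').2
    (by rw [← map_pairing, hw, map_zero])
  rw [← evalSection_congr e _ htop] at h1
  rw [Scheme.Hom.app_eq_appLE]
  exact (evalSection_fromSpec hT htop _).symm.trans ((evalSection_appLE (A := R) hT.fromSpec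
    (multiPoint K w i hu) _ T.1 htop le_rfl htop _).trans h1)

theorem graphIdeal_le_ker (G : SimpleGraph V) (w : V → Fin n → A) (i : V → Fin n)
    (hu : ∀ v, IsUnit (w v (i v))) (hw : ∀ v v', G.Adj v v' → pairing B b (w v) (w v') = 0) :
    graphIdeal G B b ≤ (multiPoint K w i hu).ker :=
  sInf_le fun v v' hvv' j j' T hj hj' =>
    equation_mem_ker B b w i hu v v' (hw v v' hvv') j j' T hj hj'

/-- The quotient of a polynomial ring by the normalizations and the edge equations represents
solutions in a fixed product of charts. -/
theorem exists_universal_coordinates (G : SimpleGraph V) (i : V → Fin n) :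
    ∃ (R : Type u) (_ : CommRing R) (_ : Algebra K R) (x : V → Fin n → R),
      (∀ v, x v (i v) = 1) ∧ (∀ v v', G.Adj v v' → pairing B b (x v) (x v') = 0) ∧
      ∀ (A : Type u) [CommRing A] [Algebra K A] (w : V → Fin n → A), (∀ v, w v (i v) = 1) →
        (∀ v v', G.Adj v v' → pairing B b (w v) (w v') = 0) →
        ∃ φ : R →ₐ[K] A, ∀ v a, φ (x v a) = w v a := by
  obtain ⟨m, ⟨e⟩⟩ := Finite.exists_equiv_fin V
  let P := MvPolynomial (Fin m × Fin n) K
  let x (v : V) (a : Fin n) : P := MvPolynomial.X (e v, a)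
  let I : Ideal P := Ideal.span (Set.range (fun v => x v (i v) - 1) ∪
    {p | ∃ v v', G.Adj v v' ∧ p = pairing B b (x v) (x v')})
  refine ⟨P ⧸ I, inferInstance, inferInstance, fun v a => Ideal.Quotient.mkₐ K I (x v a), ?_, ?_, ?_⟩
  · intro v
    rw [← sub_eq_zero, ← map_one (Ideal.Quotient.mkₐ K I), ← map_sub]
    exact Ideal.Quotient.eq_zero_iff_mem.2 (Ideal.subset_span (.inl ⟨v, rfl⟩))
  · intro v v' h
    rw [← map_pairing]
    exact Ideal.Quotient.eq_zero_iff_mem.2 (Ideal.subset_span (.inr ⟨v, v', h, rfl⟩))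
  · intro A _ _ w hw hG
    let φ : P →ₐ[K] A := MvPolynomial.aeval fun p => w (e.symm p.1) p.2
    have hφ (v a) : φ (x v a) = w v a :=
      (MvPolynomial.aeval_X _ _).trans (by simp)
    have hI : ∀ p ∈ I, φ p = 0 := by
      intro p hp
      refine (Ideal.span_le (I := RingHom.ker φ)).2 ?_ hp
      rintro _ (⟨v, rfl⟩ | ⟨v, v', h, rfl⟩)
      · simp [RingHom.mem_ker, hφ, hw]
      · simp [RingHom.mem_ker, map_pairing, hφ, hG v v' h]
    exact ⟨Ideal.Quotient.liftₐ I φ hI, fun v a => hφ v a⟩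

theorem evalSection_eq_zero_of_mem_ker {Y : Scheme.{u}} (g : Spec (.of A) ⟶ Y) (T : Y.affineOpens)
    (h : ⊤ ≤ g ⁻¹ᵁ T.1) {s : Γ(Y, T.1)} (hs : s ∈ g.ker.ideal T) : evalSection g T.1 h s = 0 := by
  have := g.ideal_ker_le T hs
  rw [RingHom.mem_ker] at this
  rw [evalSection, Scheme.Hom.appLE, CommRingCat.hom_comp, CommRingCat.hom_comp, RingHom.comp_apply,
    RingHom.comp_apply, this, map_zero, map_zero]

theorem exists_mem_chart (x : (projectiveSpace K n).left) : ∃ i, x ∈ chart K n i := by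
  have h : ⨆ i, Proj.basicOpen (grading K n) (MvPolynomial.X i) = ⊤ := by
    refine Proj.iSup_basicOpen_eq_top' (grading K n) _ (fun i => ⟨1, X_mem i⟩) ?_
    rw [← top_le_iff]
    rintro p -
    induction p using MvPolynomial.induction_on with
    | C a => exact Subalgebra.algebraMap_mem _ (algebraMap K (grading K n 0) a)
    | add p q hp hq => exact add_mem hp hq
    | mul_X p i hp => exact mul_mem hp (Algebra.subset_adjoin ⟨i, rfl⟩)
  have hx : x ∈ (⊤ : (Proj (grading K n)).Opens) := trivial
  rw [← h] at hx
  exact TopologicalSpace.Opens.mem_iSup.1 hx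

theorem exists_affineOpen_le_charts (x : (multiProjectiveSpace K V n).left) :
    ∃ T : (multiProjectiveSpace K V n).left.affineOpens, x ∈ T.1 ∧
      ∃ i : V → Fin n, ∀ v, T.1 ≤ proj K n v ⁻¹ᵁ chart K n (i v) := by
  choose i hi using fun v => exists_mem_chart (proj K n v x)
  obtain ⟨T, hT, hx, hle⟩ := exists_isAffineOpen_mem_and_subset
    (U := ⨅ v, proj K n v ⁻¹ᵁ chart K n (i v)) (x := x)
    (by rw [← SetLike.mem_coe, TopologicalSpace.Opens.coe_iInf]; exact Set.mem_iInter.2 hi)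
  exact ⟨⟨T, hT⟩, hx, i, fun v => le_trans hle (iInf_le _ v)⟩

theorem iSup_affineOpens_le_charts :
    ⨆ T : {T : (multiProjectiveSpace K V n).left.affineOpens //
      ∃ i : V → Fin n, ∀ v, T.1 ≤ proj K n v ⁻¹ᵁ chart K n (i v)}, T.1.1 = ⊤ := by
  refine top_le_iff.1 fun x _ => ?_
  obtain ⟨T, hx, hi⟩ := exists_affineOpen_le_charts x
  exact TopologicalSpace.Opens.mem_iSup.2 ⟨⟨T, hi⟩, hx⟩

/-- An infimum of quasi-coherent ideal sheaves need not be computed on affine opens, so membership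
is not formal. The kernels of the universal solutions, one for each choice of charts, form a finite
family, whose infimum is computed on affine opens. It contains the equations, and it lies below
every ideal sheaf containing them. -/
theorem equation_mem_graphIdeal (G : SimpleGraph V) {v v' : V} (hvv' : G.Adj v v') (j j' : Fin n)
    (T : (multiProjectiveSpace K V n).left.affineOpens)
    (hj : T.1 ≤ proj K n v ⁻¹ᵁ chart K n j) (hj' : T.1 ≤ proj K n v' ⁻¹ᵁ chart K n j') :
    equation B b v v' j j' T.1 hj hj' ∈ (graphIdeal G B b).ideal T := by
  choose R _ _ x hx hxG hlift using exists_universal_coordinates (K := K) B b G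
  let g (i : V → Fin n) := multiPoint K (x i) i fun v => hx i v ▸ isUnit_one
  have hle : ⨅ i, (g i).ker ≤ graphIdeal G B b := by
    refine le_sInf fun J hJ => ?_
    refine Scheme.IdealSheafData.le_of_iSup_eq_top (fun T : {T :
      (multiProjectiveSpace K V n).left.affineOpens // ∃ i : V → Fin n,
      ∀ v, T.1 ≤ proj K n v ⁻¹ᵁ chart K n (i v)} => T.1) iSup_affineOpens_le_charts ?_
    rintro ⟨T, i, hi⟩ s hs
    dsimp only at hs ⊢
    rw [Scheme.IdealSheafData.ideal_iInf, iInf_apply] at hs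
    replace hs := (Ideal.mem_iInf.1 hs) i
    -- The tautological point over `R'` satisfies the equations because they lie in `J`, so it
    -- factors through the universal solution. A section killed by the latter is therefore zero in
    -- `R'`.
    let R' := Γ((multiProjectiveSpace K V n).left, T.1) ⧸ J.ideal T
    let k : Spec (.of R') ⟶ (multiProjectiveSpace K V n).left :=
      Spec.map (CommRingCat.ofHom (Ideal.Quotient.mk (J.ideal T))) ≫ T.2.fromSpec
    obtain ⟨ψ, hψ⟩ := Spec.map_surjective (k ≫ (multiProjectiveSpace K V n).hom)
    let _ : Algebra K R' := ψ.hom.toAlgebra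
    have hT : ⊤ ≤ T.2.fromSpec ⁻¹ᵁ T.1 := by rw [T.2.fromSpec_preimage_self]
    have hk : ⊤ ≤ k ⁻¹ᵁ T.1 := fun y _ => hT (x := Spec.map _ y) trivial
    have hks (s) : evalSection k T.1 hk s = Ideal.Quotient.mk (J.ideal T) s :=
      (evalSection_SpecMap (A := Γ((multiProjectiveSpace K V n).left, T.1)) _ _ _ hT hk s).trans
        (congrArg _ (evalSection_fromSpec T.2 hT s))
    obtain ⟨w, hw, hkw⟩ := exists_eq_multiPoint k hψ.symm i fun v => hk.trans fun y hy => hi v hy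
    obtain ⟨φ, hφ⟩ := hlift i R' w hw fun v v' hvv' => by
      rw [← evalSection_equation_eq_zero_iff B b w i (fun v => hw v ▸ isUnit_one) v v' (i v) (i v')
        T.1 (hkw ▸ hk) (hi v) (hi v'), ← evalSection_congr hkw _ hk, hks,
        Ideal.Quotient.eq_zero_iff_mem]
      exact hJ v v' hvv' _ _ T _ _
    have hkg : k = Spec.map (CommRingCat.ofHom φ.toRingHom) ≫ g i := by
      rw [hkw, SpecMap_multiPoint φ _ _ _ fun v => by rw [hφ, hw]; exact isUnit_one]
      simp only [hφ]
    rw [← Ideal.Quotient.eq_zero_iff_mem, ← hks]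
    refine evalSection_eq_zero_of_mem_ker k T hk ?_
    rw [hkg]
    exact Scheme.Hom.le_ker_comp _ _ T hs
  refine hle T ?_
  rw [Scheme.IdealSheafData.ideal_iInf, iInf_apply, Ideal.mem_iInf]
  exact fun i => equation_mem_ker B b _ _ _ v v' (hxG i v v' hvv') j j' T hj hj'

end Ideal

end GraphVariety

/-! ### Leaves, cycles and degeneracy -/

namespace SimpleGraph

variable {V : Type*} {G : SimpleGraph V}

/-- Take an endpoint of a longest path. Maximality puts its neighbours on the path, and acyclicity
leaves only the next vertex. -/
theorem IsAcyclic.exists_forall_adj_eq [Finite V] [Nonempty V] (h : G.IsAcyclic) :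
    ∃ v, ∀ x y, G.Adj v x → G.Adj v y → x = y := by
  obtain ⟨u, v, p, hp, hmax⟩ := Walk.exists_isPath_forall_isPath_length_le_length G
  refine ⟨u, ?_⟩
  have key (x : V) (hx : G.Adj u x) : x = p.snd := by
    refine h.eq_snd_of_adj_start hp hx ?_
    by_contra hxp
    have := hmax _ _ (Walk.cons hx.symm p) (hp.cons hxp)
    simp at this
  exact fun x y hx hy => (key x hx).trans (key y hy).symm

theorem IsAcyclic.exists_mem_forall_adj_eq (h : G.IsAcyclic) (s : Finset V)
    (hs : s.Nonempty) :
    ∃ v ∈ s, ∀ x ∈ s, ∀ y ∈ s, G.Adj v x → G.Adj v y → x = y := by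
  have : Nonempty (s : Set V) := hs.to_subtype
  have : Finite (s : Set V) := s.finite_toSet
  obtain ⟨v, hv⟩ := (h.induce (s : Set V)).exists_forall_adj_eq
  exact ⟨v, v.2, fun x hx y hy hvx hvy => congrArg Subtype.val (hv ⟨x, hx⟩ ⟨y, hy⟩ hvx hvy)⟩

theorem exists_adj_and_reachable_deleteEdges (h : ¬ G.IsAcyclic) :
    ∃ v w, G.Adj v w ∧ (G.deleteEdges {s(v, w)}).Reachable v w := by
  rw [isAcyclic_iff_forall_adj_isBridge] at h
  push Not at h
  obtain ⟨v, w, hvw, hb⟩ := h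
  rw [isBridge_iff, not_not] at hb
  exact ⟨v, w, hvw, hb⟩

theorem Reachable.eq_of_forall_adj_eq {α : Type*} {f : V → α} (h : ∀ v w, G.Adj v w → f v = f w)
    {v w : V} (hvw : G.Reachable v w) : f v = f w := by
  obtain ⟨p⟩ := hvw
  induction p with
  | nil => rfl
  | cons hadj _ ih => exact (h _ _ hadj).trans ih

theorem two_le_maxDegree [Fintype V] [DecidableRel G.Adj] (h : ¬ G.IsAcyclic) :
    2 ≤ G.maxDegree := by
  classical
  simp only [IsAcyclic, not_forall, not_not] at h
  obtain ⟨v, c, hc⟩ := h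
  refine le_trans ?_ (G.degree_le_maxDegree v)
  rw [← G.card_neighborFinset_eq_degree]
  refine Finset.one_lt_card.2 ⟨c.snd, ?_, c.penultimate, ?_, hc.snd_ne_penultimate⟩
  · simpa using c.adj_snd hc.not_nil
  · simpa using (c.adj_penultimate hc.not_nil).symm

/-- The least vertex of a cycle has two larger neighbours on it. -/
theorem IsDegenerate.two_le [Finite V] {d : ℕ} (hd : G.IsDegenerate d) (h : ¬ G.IsAcyclic) :
    2 ≤ d := by
  classical
  obtain ⟨_, hd⟩ := hd
  simp only [IsAcyclic, not_forall, not_not] at h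
  obtain ⟨v, c, hc⟩ := h
  obtain ⟨m, hm, hmin⟩ := c.support.toFinset.exists_min_image id ⟨v, by simp⟩
  rw [List.mem_toFinset] at hm
  have hc' := hc.rotate hm
  have hlt (x : V) (hx : x ∈ (c.rotate m hm).support) (hmx : G.Adj m x) :
      x ∈ {w : V | m < w ∧ G.Adj m w} := by
    refine ⟨lt_of_le_of_ne (hmin x ?_) hmx.ne, hmx⟩
    rw [List.mem_toFinset]
    exact (c.mem_support_rotate_iff m hm).1 hx
  refine le_trans ?_ (hd m)
  refine (Set.one_lt_ncard_iff (Set.toFinite _)).2 ⟨(c.rotate m hm).snd, (c.rotate m hm).penultimate,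
    hlt _ ?_ ?_, hlt _ ?_ ?_, hc'.snd_ne_penultimate⟩
  · exact (c.rotate m hm).getVert_mem_support _
  · exact (c.rotate m hm).adj_snd hc'.not_nil
  · exact (c.rotate m hm).getVert_mem_support _
  · exact ((c.rotate m hm).adj_penultimate hc'.not_nil).symm

end SimpleGraph

/-! ### Choice of the perturbation vectors -/

namespace LinearMap.BilinForm

variable {K W : Type*} [Field K] [AddCommGroup W] [Module K W] [FiniteDimensional K W]
  {B : LinearMap.BilinForm K W}

/-- Otherwise the kernel of `B u`, of codimension at most one, would be isotropic and so have at
most half the dimension, forcing dimension at most `2`. In `exists_not_liftable`, `φ` is a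
coordinate: its vanishing keeps the perturbed vectors normalized. -/
theorem exists_eq_one_of_three_le_finrank (hB : B.Nondegenerate) (hAlt : B.IsAlt)
    (h : 3 ≤ Module.finrank K W) {u : W} {φ : W →ₗ[K] K} (hu : φ u ≠ 0) :
    ∃ x y, B u x = 0 ∧ B u y = 0 ∧ φ x = 0 ∧ φ y = 0 ∧ B x y = 1 := by
  by_contra hcon
  let P : Submodule K W := LinearMap.ker (B u)
  have hP : Module.finrank K W ≤ Module.finrank K P + 1 := by
    have := (B u).finrank_range_add_finrank_ker
    have h1 : Module.finrank K (LinearMap.range (B u)) ≤ 1 := by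
      simpa using Submodule.finrank_le (LinearMap.range (B u))
    change _ ≤ Module.finrank K (LinearMap.ker (B u)) + 1
    omega
  have hiso : ∀ x ∈ P, ∀ y ∈ P, B x y = 0 := by
    intro x hx y hy
    by_contra hxy
    rw [LinearMap.mem_ker] at hx hy
    -- Subtracting multiples of `u` kills `φ` and does not change the pairing, since `u` is
    -- orthogonal to `x`, `y` and itself.
    refine hcon ⟨(B x y)⁻¹ • (x - (φ x / φ u) • u), y - (φ y / φ u) • u, ?_, ?_, ?_, ?_, ?_⟩
    · simp [hx, hAlt.self_eq_zero]
    · simp [hy, hAlt.self_eq_zero]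
    · simp [hu]
    · simp [hu]
    · have : B x u = 0 := by rw [← hAlt.neg_eq, hx, neg_zero]
      simp [hAlt.self_eq_zero, hy, this, hxy]
  have hle : P ≤ B.orthogonal P := fun y hy x hx => hiso x hx y hy
  have h2 := Submodule.finrank_mono hle
  rw [LinearMap.BilinForm.finrank_orthogonal hB] at h2
  omega

end LinearMap.BilinForm

/-! ### Lifting solutions of the edge equations -/

namespace GraphVariety

variable {K : Type u} [Field K] {n : ℕ} {V : Type*} {A : Type u} [CommRing A]
  [Algebra K A] {W : Type*} [AddCommGroup W] [Module K W]
  (B : LinearMap.BilinForm K W) (b : Module.Basis (Fin n) K W)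

theorem pairing_add_left (x x' y : Fin n → A) :
    pairing B b (x + x') y = pairing B b x y + pairing B b x' y := by
  simp [pairing, add_mul, Finset.sum_add_distrib]

theorem pairing_add_right (x y y' : Fin n → A) :
    pairing B b x (y + y') = pairing B b x y + pairing B b x y' := by
  simp [pairing, mul_add, Finset.sum_add_distrib]

theorem pairing_smul_left (c : A) (x y : Fin n → A) :
    pairing B b (c • x) y = c * pairing B b x y := by
  simp [pairing, Finset.mul_sum, mul_assoc]

theorem pairing_smul_right (c : A) (x y : Fin n → A) :
    pairing B b x (c • y) = c * pairing B b x y := by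
  simp only [pairing, Finset.mul_sum, Pi.smul_apply, smul_eq_mul]
  exact Finset.sum_congr rfl fun _ _ => Finset.sum_congr rfl fun _ _ => by ring

theorem pairing_swap (hAlt : B.IsAlt) (x y : Fin n → A) :
    pairing B b y x = -pairing B b x y := by
  simp only [pairing, Finset.mul_sum, ← Finset.sum_neg_distrib]
  rw [Finset.sum_comm]
  refine Finset.sum_congr rfl fun _ _ => Finset.sum_congr rfl fun _ _ => ?_
  rw [← hAlt.neg_eq, map_neg]
  ring

theorem pairing_repr_left (u : W) (y : Fin n → A) :
    pairing B b (fun a => algebraMap K A (b.repr u a)) y = ∑ e, algebraMap K A (B u (b e)) * y e := by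
  conv_rhs => rw [← b.sum_repr u]
  simp only [pairing, Finset.mul_sum, map_sum, LinearMap.sum_apply, map_smul, LinearMap.smul_apply,
    smul_eq_mul, map_mul, Finset.sum_mul]
  rw [Finset.sum_comm]
  simp only [mul_assoc]

theorem pairing_repr (u u' : W) :
    pairing B b (fun a => algebraMap K A (b.repr u a)) (fun a => algebraMap K A (b.repr u' a)) =
      algebraMap K A (B u u') := by
  conv_rhs => rw [← b.sum_repr u']
  simp [pairing_repr_left, -Module.Basis.sum_repr, mul_comm]

/-- Nondegeneracy over `K` makes the `i`-th coordinate a pairing with a fixed vector; rescale by the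
inverse of `z i`. -/
theorem exists_pairing_eq_one (hB : B.Nondegenerate) (z : Fin n → A) (i : Fin n)
    (hz : IsUnit (z i)) : ∃ y, pairing B b y z = 1 := by
  have : Module.Finite K W := Module.Finite.of_basis b
  obtain ⟨c, hc⟩ := hz.exists_left_inv
  refine ⟨c • fun a => algebraMap K A (b.repr ((B.toDual hB).symm (b.coord i)) a), ?_⟩
  rw [pairing_smul_left, pairing_repr_left, ← hc]
  congr 1
  have h (e : Fin n) : B ((B.toDual hB).symm (b.coord i)) (b e) = b.coord i (b e) := by
    rw [← LinearMap.BilinForm.toDual_def hB, LinearEquiv.apply_symm_apply]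
  simp [h, Finsupp.single_apply]

theorem pairing_sub_mem {I : Ideal A} {x x' y y' : Fin n → A} (hx : ∀ a, x a - x' a ∈ I)
    (hy : ∀ a, y a - y' a ∈ I) : pairing B b x y - pairing B b x' y' ∈ I := by
  have h (z : A) : z ∈ I ↔ Ideal.Quotient.mkₐ K I z = 0 := Ideal.Quotient.eq_zero_iff_mem.symm
  simp only [h, map_sub, sub_eq_zero] at hx hy ⊢
  simp only [map_pairing, hx, hy]

/-- Solutions of the equations attached to the edges of a forest can be lifted along an ideal of
square zero. -/
theorem exists_lift_of_isAcyclic [Finite V] {G : SimpleGraph V} (hG : G.IsAcyclic) (hAlt : B.IsAlt)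
    (hB : B.Nondegenerate) {I : Ideal A} (hI : I ^ 2 = ⊥) (w₀ : V → Fin n → A) (i : V → Fin n)
    (hu : ∀ v, IsUnit (w₀ v (i v))) (h₀ : ∀ v v', G.Adj v v' → pairing B b (w₀ v) (w₀ v') ∈ I) :
    ∃ w : V → Fin n → A, (∀ v a, w v a - w₀ v a ∈ I) ∧
      ∀ v v', G.Adj v v' → pairing B b (w v) (w v') = 0 := by
  classical
  have := Fintype.ofFinite V
  suffices h : ∀ s : Finset V, ∃ w : V → Fin n → A, (∀ v a, w v a - w₀ v a ∈ I) ∧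
      ∀ v ∈ s, ∀ v' ∈ s, G.Adj v v' → pairing B b (w v) (w v') = 0 by
    obtain ⟨w, hw, hw'⟩ := h Finset.univ
    exact ⟨w, hw, fun v v' => hw' v (Finset.mem_univ v) v' (Finset.mem_univ v')⟩
  intro s
  induction s using Finset.strongInduction with
  | H s ih =>
  rcases s.eq_empty_or_nonempty with rfl | hs
  · exact ⟨w₀, by simp, by simp⟩
  obtain ⟨v, hv, hleaf⟩ := hG.exists_mem_forall_adj_eq s hs
  obtain ⟨w, hw, hw'⟩ := ih _ (Finset.erase_ssubset hv)
  by_cases hex : ∃ u ∈ s, G.Adj v u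
  · obtain ⟨u, hus, hvu⟩ := hex
    -- The lift changes this coordinate only by a nilpotent.
    have hwu : IsUnit (w u (i u)) := by
      have hnil : IsNilpotent (w u (i u) - w₀ u (i u)) :=
        ⟨2, by simpa [hI] using Ideal.pow_mem_pow (hw u (i u)) 2⟩
      simpa using hnil.isUnit_add_left_of_commute (hu u) (Commute.all _ _)
    obtain ⟨y, hy⟩ := exists_pairing_eq_one B b hB (w u) (i u) hwu
    have hε : pairing B b (w v) (w u) ∈ I := by
      simpa using add_mem (pairing_sub_mem B b (hw v) (hw u)) (h₀ v u hvu)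
    -- The coefficient lies in `I`, so `w v` keeps its class modulo `I`; `u` is the only neighbour
    -- of `v` in `s`, so no other equation is affected.
    let z : Fin n → A := w v + (-pairing B b (w v) (w u)) • y
    have hz : pairing B b z (w u) = 0 := by
      rw [pairing_add_left, pairing_smul_left, hy]
      ring
    refine ⟨Function.update w v z, ?_, ?_⟩
    · intro v' a
      rcases eq_or_ne v' v with rfl | hne
      · have : w v' a - w₀ v' a + -pairing B b (w v') (w u) * y a ∈ I :=
          add_mem (hw v' a) (I.mul_mem_right _ (neg_mem hε))
        simpa [z, add_sub_right_comm] using this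
      · simpa [hne] using hw v' a
    · intro v₁ h₁ v₂ h₂ hadj
      rcases eq_or_ne v₁ v with rfl | hne₁
      · obtain rfl := hleaf v₂ h₂ u hus hadj hvu
        simpa [hadj.ne'] using hz
      rcases eq_or_ne v₂ v with rfl | hne₂
      · obtain rfl := hleaf v₁ h₁ u hus hadj.symm hvu
        rw [pairing_swap B b hAlt]
        simpa [hadj.ne] using hz
      simpa [hne₁, hne₂] using hw' v₁ (by simp [hne₁, h₁]) v₂ (by simp [hne₂, h₂]) hadj
  · push Not at hex
    refine ⟨w, hw, fun v₁ h₁ v₂ h₂ hadj => ?_⟩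
    have hne₁ : v₁ ≠ v := by rintro rfl; exact hex v₂ h₂ hadj
    have hne₂ : v₂ ≠ v := by rintro rfl; exact hex v₁ h₁ hadj.symm
    exact hw' v₁ (by simp [hne₁, h₁]) v₂ (by simp [hne₂, h₂]) hadj

/-- Over a ring with an element `t` such that `t ^ 3 = 0` and `t ^ 2 ≠ 0`, the equations attached
to a graph with a cycle have a solution modulo `t ^ 2` that does not lift. -/
theorem exists_not_liftable {G : SimpleGraph V} (hG : ¬ G.IsAcyclic) (hAlt : B.IsAlt)
    (hB : B.Nondegenerate) (hn : 3 ≤ n) {t : A} (ht : t ^ 3 = 0) (ht' : t ^ 2 ≠ 0) :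
    ∃ (w₀ : V → Fin n → A) (i : V → Fin n), (∀ v, w₀ v (i v) = 1) ∧
      (∀ v v', G.Adj v v' → pairing B b (w₀ v) (w₀ v') ∈ Ideal.span {t ^ 2}) ∧
      ¬ ∃ w : V → Fin n → A, (∀ v a, w v a - w₀ v a ∈ Ideal.span {t ^ 2}) ∧
        ∀ v v', G.Adj v v' → pairing B b (w v) (w v') = 0 := by
  classical
  have : Module.Finite K W := Module.Finite.of_basis b
  obtain ⟨p, q, hpq, hreach⟩ := SimpleGraph.exists_adj_and_reachable_deleteEdges hG
  let i₀ : Fin n := ⟨0, by omega⟩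
  obtain ⟨x, y, hx, hy, hx', hy', hxy⟩ :=
    LinearMap.BilinForm.exists_eq_one_of_three_le_finrank hB hAlt
      (by rwa [Module.finrank_eq_card_basis b, Fintype.card_fin]) (u := b i₀) (φ := b.coord i₀)
      (by simp)
  let e (z : W) : Fin n → A := fun a => algebraMap K A (b.repr z a)
  have he (z z' : W) : pairing B b (e z) (e z') = algebraMap K A (B z z') := pairing_repr B b z z'
  -- Among the edges, only `pq` has a nonzero pairing of its two perturbations.
  let γ (v : V) : W := if v = p then x else if v = q then y else 0
  have hγ (v : V) : B (b i₀) (γ v) = 0 := by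
    dsimp only [γ]; split_ifs <;> simp [hx, hy]
  have hγ' (v : V) : B (γ v) (b i₀) = 0 := by rw [← hAlt.neg_eq, hγ, neg_zero]
  have hγ'' (v : V) : b.repr (γ v) i₀ = 0 := by
    have h1 : b.repr x i₀ = 0 := hx'
    have h2 : b.repr y i₀ = 0 := hy'
    dsimp only [γ]; split_ifs <;> simp [h1, h2]
  let w₀ (v : V) : Fin n → A := e (b i₀) + t • e (γ v)
  have hw₀ (v v' : V) : pairing B b (w₀ v) (w₀ v') = t ^ 2 * algebraMap K A (B (γ v) (γ v')) := by
    simp only [w₀, pairing_add_left, pairing_add_right, pairing_smul_left, pairing_smul_right, he,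
      hγ, hγ', hAlt.self_eq_zero, map_zero]
    ring
  refine ⟨w₀, fun _ => i₀, ?_, ?_, ?_⟩
  · intro v
    simp [w₀, e, hγ'']
  · intro v v' _
    rw [hw₀]
    exact Ideal.mul_mem_right _ _ (Ideal.mem_span_singleton_self _)
  · rintro ⟨w, hw, hwG⟩
    have hc (v : V) : ∃ c : Fin n → A, w v = w₀ v + t ^ 2 • c := by
      choose c hc using fun a => Ideal.mem_span_singleton'.1 (hw v a)
      refine ⟨c, funext fun a => ?_⟩
      have := hc a
      simp only [Pi.add_apply, Pi.smul_apply, smul_eq_mul]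
      linear_combination -this
    choose c hc using hc
    -- Only the pairing of the correction `c v` with the common base vector survives, as all other
    -- terms involving `c` carry a factor `t ^ 3`. By skew-symmetry it enters an edge equation as `f
    -- v' - f v`.
    let f (v : V) : A := t ^ 2 * pairing B b (e (b i₀)) (c v)
    have key (v v' : V) (h : G.Adj v v') :
        t ^ 2 * algebraMap K A (B (γ v) (γ v')) + f v' - f v = 0 := by
      have := hwG v v' h
      rw [hc, hc, pairing_add_left, pairing_add_right B b (w₀ v) (w₀ v'),
        pairing_add_right B b (t ^ 2 • c v) (w₀ v'), hw₀] at this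
      simp only [w₀, pairing_add_left, pairing_add_right, pairing_smul_left, pairing_smul_right]
        at this
      rw [pairing_swap B b hAlt (e (b i₀)) (c v)] at this
      simp only [f]
      linear_combination this - (pairing B b (e (γ v)) (c v') + pairing B b (c v) (e (γ v')) +
        t * pairing B b (c v) (c v')) * ht
    have hconst (v v' : V) (h : (G.deleteEdges {s(p, q)}).Adj v v') : f v = f v' := by
      rw [SimpleGraph.deleteEdges_adj] at h
      have h0 : B (γ v) (γ v') = 0 := by
        have := h.1.ne
        have := h.2
        simp only [Set.mem_singleton_iff, Sym2.eq_iff] at this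
        dsimp only [γ]
        split_ifs <;> simp_all
      have := key v v' h.1
      rw [h0, map_zero] at this
      linear_combination -this
    -- Following the rest of the cycle, which avoids `pq`, leaves only `t ^ 2` in the equation of
    -- `pq`.
    have hf : f p = f q := hreach.eq_of_forall_adj_eq hconst
    have := key p q hpq
    simp only [hf, γ, if_true, hpq.ne', if_false, hxy, map_one] at this
    exact ht' (by linear_combination this)

end GraphVariety

/-! ### Smoothness and infinitesimal lifting -/

namespace GraphVariety

section

variable {A : Type u} [CommRing A] {Y : Scheme.{u}}

theorem exists_eq_SpecMap_fromSpec {T : Y.Opens} (hT : IsAffineOpen T) (h : Spec (.of A) ⟶ Y)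
    (hh : ⊤ ≤ h ⁻¹ᵁ T) :
    ∃ ρ : Γ(Y, T) →+* A, h = Spec.map (CommRingCat.ofHom ρ) ≫ hT.fromSpec := by
  have hr : Set.range h ⊆ Set.range hT.fromSpec := by
    rw [hT.range_fromSpec]
    rintro _ ⟨x, rfl⟩
    exact hh (x := x) trivial
  obtain ⟨ρ, hρ⟩ := Spec.map_surjective (IsOpenImmersion.lift hT.fromSpec h hr)
  refine ⟨ρ.hom, ?_⟩
  rw [CommRingCat.ofHom_hom, hρ, IsOpenImmersion.lift_fac]

theorem surjective_SpecMap_mk {I : Ideal A} (hI : I ^ 2 = ⊥) :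
    Function.Surjective (Spec.map (CommRingCat.ofHom (Ideal.Quotient.mk I))) := by
  intro x
  have hx (y : PrimeSpectrum A) : y ∈ Set.range (PrimeSpectrum.comap (Ideal.Quotient.mk I)) := by
    rw [range_comap_of_surjective _ _ Ideal.Quotient.mk_surjective, Ideal.mk_ker,
      PrimeSpectrum.mem_zeroLocus]
    intro a ha
    refine y.2.mem_of_pow_mem 2 ?_
    have : a ^ 2 ∈ I ^ 2 := Ideal.pow_mem_pow ha 2
    rw [hI, Ideal.mem_bot] at this
    rw [this]
    exact zero_mem _
  exact hx x

/-- A square-zero thickening has the same points, so landing in an open set can be checked modulo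
`I`. -/
theorem top_le_preimage_of_SpecMap_mk {I : Ideal A} (hI : I ^ 2 = ⊥) (g : Spec (.of A) ⟶ Y)
    (T : Y.Opens)
    (h : ⊤ ≤ (Spec.map (CommRingCat.ofHom (Ideal.Quotient.mk I)) ≫ g) ⁻¹ᵁ T) :
    ⊤ ≤ g ⁻¹ᵁ T := by
  intro x _
  obtain ⟨y, rfl⟩ := surjective_SpecMap_mk hI x
  exact h (x := y) trivial

instance isZariskiLocalAtSource_smooth : IsZariskiLocalAtSource @Smooth.{u} :=
  HasRingHomProperty.instIsZariskiLocalAtSource (P := @Smooth)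

theorem smooth_of_SpecMap_eq {R : CommRingCat.{u}} {f : Y ⟶ Spec R} (hf : Smooth f) {T : Y.Opens}
    (hT : IsAffineOpen T) {θ : R ⟶ Γ(Y, T)} (hθ : Spec.map θ = hT.fromSpec ≫ f) :
    θ.hom.Smooth := by
  rw [← HasRingHomProperty.Spec_iff (P := @Smooth), hθ]
  exact IsZariskiLocalAtSource.comp (P := @Smooth) hf _

/-- Over a noetherian base, finite type gives finite presentation, so formal smoothness on an affine
cover suffices. -/
theorem smooth_of_iSup_eq_top {R : CommRingCat.{u}} [IsNoetherianRing R] (f : Y ⟶ Spec R)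
    [LocallyOfFiniteType f] {κ : Type*} {T : κ → Y.Opens} (hT : ∀ k, IsAffineOpen (T k))
    (hsup : iSup T = ⊤)
    (H : ∀ k (θ : R ⟶ Γ(Y, T k)), Spec.map θ = (hT k).fromSpec ≫ f → θ.hom.FormallySmooth) :
    Smooth f := by
  refine (IsZariskiLocalAtSource.iff_of_iSup_eq_top (P := @Smooth) T hsup).2 fun k => ?_
  obtain ⟨θ, hθ⟩ := Spec.map_surjective ((hT k).fromSpec ≫ f)
  have h1 : (T k).ι ≫ f = (hT k).isoSpec.hom ≫ Spec.map θ := by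
    rw [hθ, IsAffineOpen.fromSpec, Category.assoc, Iso.hom_inv_id_assoc]
  rw [h1]
  refine IsZariskiLocalAtSource.comp (P := @Smooth) ?_ _
  rw [HasRingHomProperty.Spec_iff (P := @Smooth), RingHom.smooth_def]
  refine ⟨H k θ hθ, ?_⟩
  have h2 : LocallyOfFiniteType (Spec.map θ) := by
    rw [hθ]; infer_instance
  rw [HasRingHomProperty.Spec_iff (P := @LocallyOfFiniteType)] at h2
  exact RingHom.FinitePresentation.of_finiteType.1 h2

end

variable {K : Type u} [Field K] {n : ℕ} {V : Type*} [Finite V] {A : Type u} [CommRing A]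
  [Algebra K A] {W : Type*} [AddCommGroup W] [Module K W]
  (B : LinearMap.BilinForm K W) (b : Module.Basis (Fin n) K W) (G : SimpleGraph V)

theorem pairing_eq_zero_of_graphIdeal_le_ker (w : V → Fin n → A) (i : V → Fin n)
    (hu : ∀ v, IsUnit (w v (i v))) (hle : graphIdeal G B b ≤ (multiPoint K w i hu).ker)
    (T : (multiProjectiveSpace K V n).left.affineOpens) (hT : ⊤ ≤ multiPoint K w i hu ⁻¹ᵁ T.1)
    (j : V → Fin n) (hj : ∀ v, T.1 ≤ proj K n v ⁻¹ᵁ chart K n (j v)) {v v' : V}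
    (h : G.Adj v v') : pairing B b (w v) (w v') = 0 :=
  (evalSection_equation_eq_zero_iff B b w i hu v v' (j v) (j v') T.1 hT (hj v) (hj v')).1
    (evalSection_eq_zero_of_mem_ker _ T hT
      (hle T (equation_mem_graphIdeal B b G h (j v) (j v') T (hj v) (hj v'))))

theorem graphIdeal_le_ker_comp {S : Scheme.{u}} (h : S ⟶ (graphIdeal G B b).subscheme) :
    graphIdeal G B b ≤ (h ≫ (graphIdeal G B b).subschemeι).ker := by
  conv_lhs => rw [← (graphIdeal G B b).ker_subschemeι]
  exact Scheme.Hom.le_ker_comp _ _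

theorem multiPoint_congr {w w' : V → Fin n → A} (hw : w = w') (i : V → Fin n)
    (hu : ∀ v, IsUnit (w v (i v))) : multiPoint K w i hu = multiPoint K w' i (hw ▸ hu) := by
  subst hw; rfl

/-- The infinitesimal lifting property of the affine pieces of the graph variety of a forest. -/
theorem formallySmooth_of_isAcyclic (hG : G.IsAcyclic) (hAlt : B.IsAlt) (hB : B.Nondegenerate)
    (T : (multiProjectiveSpace K V n).left.affineOpens) (i : V → Fin n)
    (hi : ∀ v, T.1 ≤ proj K n v ⁻¹ᵁ chart K n (i v))
    (hT : IsAffineOpen ((graphIdeal G B b).subschemeι ⁻¹ᵁ T.1))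
    (θ : K →+* Γ((graphIdeal G B b).subscheme, (graphIdeal G B b).subschemeι ⁻¹ᵁ T.1))
    (hθ : Spec.map (CommRingCat.ofHom θ) =
      hT.fromSpec ≫ (projectiveGraphVariety G B b).hom) : θ.FormallySmooth := by
  let _ := θ.toAlgebra
  refine Algebra.FormallySmooth.of_comp_surjective fun A _ _ I hI φ => ?_
  have hθ' : Spec.map (CommRingCat.ofHom θ) = hT.fromSpec ≫ (graphIdeal G B b).subschemeι ≫
    (multiProjectiveSpace K V n).hom := hθ
  let g : Spec (.of (A ⧸ I)) ⟶ (graphIdeal G B b).subscheme :=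
    Spec.map (CommRingCat.ofHom φ.toRingHom) ≫ hT.fromSpec
  have hgT : ⊤ ≤ g ⁻¹ᵁ ((graphIdeal G B b).subschemeι ⁻¹ᵁ T.1) := by
    intro x _
    have : Spec.map (CommRingCat.ofHom φ.toRingHom) x ∈
        hT.fromSpec ⁻¹ᵁ ((graphIdeal G B b).subschemeι ⁻¹ᵁ T.1) := by
      rw [hT.fromSpec_preimage_self]; trivial
    exact this
  have hgK : (g ≫ (graphIdeal G B b).subschemeι) ≫ (multiProjectiveSpace K V n).hom =
      Spec.map (CommRingCat.ofHom (algebraMap K (A ⧸ I))) := by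
    rw [Category.assoc, Category.assoc, ← hθ', ← Spec.map_comp, ← CommRingCat.ofHom_comp]
    congr 2
    exact φ.comp_algebraMap
  obtain ⟨w', hw', hgw'⟩ := exists_eq_multiPoint _ hgK i fun v x hx => hi v (hgT hx)
  have hw'G (v v' : V) (h : G.Adj v v') : pairing B b (w' v) (w' v') = 0 := by
    refine pairing_eq_zero_of_graphIdeal_le_ker B b G w' i (fun v => hw' v ▸ isUnit_one) ?_ T ?_ i hi
      h
    · rw [← hgw']; exact graphIdeal_le_ker_comp B b G g
    · rw [← hgw']; exact hgT
  choose w₀ hw₀ using fun v a => Ideal.Quotient.mk_surjective (w' v a)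
  have hunit (z : A) (hz : Ideal.Quotient.mk I z = 1) : IsUnit z :=
    (IsNilpotent.isUnit_quotient_mk_iff ⟨2, hI⟩).1 (hz ▸ isUnit_one)
  obtain ⟨w, hw, hwG⟩ := exists_lift_of_isAcyclic B b hG hAlt hB hI w₀ i
    (fun v => hunit _ ((hw₀ v (i v)).trans (hw' v))) fun v v' h => by
      have := map_pairing B b (Ideal.Quotient.mkₐ K I) (w₀ v) (w₀ v')
      simp only [Ideal.Quotient.mkₐ_eq_mk, hw₀, hw'G v v' h] at this
      exact Ideal.Quotient.eq_zero_iff_mem.1 this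
  have hww' : (fun v a => Ideal.Quotient.mkₐ K I (w v a)) = w' := by
    funext v a
    rw [← hw₀]
    exact Ideal.Quotient.eq.2 (hw v a)
  have hu (v : V) : IsUnit (w v (i v)) := hunit _ (congr($hww' v (i v)).trans (hw' v))
  let h : Spec (.of A) ⟶ (graphIdeal G B b).subscheme :=
    IsClosedImmersion.lift (graphIdeal G B b).subschemeι (multiPoint K w i hu)
      ((graphIdeal G B b).ker_subschemeι.trans_le (graphIdeal_le_ker B b G w i hu hwG))
  have hhw : h ≫ (graphIdeal G B b).subschemeι = multiPoint K w i hu :=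
    IsClosedImmersion.lift_fac _ _ _
  have hhg : Spec.map (CommRingCat.ofHom (Ideal.Quotient.mk I)) ≫ h = g := by
    rw [← cancel_mono (graphIdeal G B b).subschemeι, hgw', Category.assoc, hhw]
    exact (SpecMap_multiPoint (Ideal.Quotient.mkₐ K I) w i hu fun v => (hu v).map _).trans
      (multiPoint_congr hww' i _)
  obtain ⟨ρ, hρ⟩ := exists_eq_SpecMap_fromSpec hT h
    (top_le_preimage_of_SpecMap_mk hI h _ (hhg ▸ hgT))
  refine ⟨{ ρ with commutes' := ?_ }, ?_⟩
  · have h1 : h ≫ (graphIdeal G B b).subschemeι ≫ (multiProjectiveSpace K V n).hom =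
        Spec.map (CommRingCat.ofHom (algebraMap K A)) := by
      rw [← Category.assoc, hhw, multiPoint_comp_hom]
    rw [hρ, Category.assoc, ← hθ', ← Spec.map_comp, Spec.map_inj, ← CommRingCat.ofHom_comp] at h1
    exact fun r => congr($(h1).hom r)
  · rw [hρ, ← Category.assoc, cancel_mono, ← Spec.map_comp, Spec.map_inj,
      ← CommRingCat.ofHom_comp] at hhg
    exact AlgHom.ext fun r => congr($(hhg).hom r)

theorem exists_preimage_affineOpen (x : (graphIdeal G B b).subscheme) :
    ∃ T : (multiProjectiveSpace K V n).left.affineOpens,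
      IsAffineOpen ((graphIdeal G B b).subschemeι ⁻¹ᵁ T.1) ∧
      x ∈ (graphIdeal G B b).subschemeι ⁻¹ᵁ T.1 ∧
      ∃ i : V → Fin n, ∀ v, T.1 ≤ proj K n v ⁻¹ᵁ chart K n (i v) := by
  obtain ⟨T, hxT, i, hi⟩ := exists_affineOpen_le_charts ((graphIdeal G B b).subschemeι x)
  exact ⟨T, T.2.preimage _, hxT, i, hi⟩

theorem smooth_of_isAcyclic (hG : G.IsAcyclic) (hAlt : B.IsAlt) (hB : B.Nondegenerate) :
    Smooth (projectiveGraphVariety G B b).hom := by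
  choose T hT hxT i hi using exists_preimage_affineOpen B b G
  have : LocallyOfFiniteType (projectiveGraphVariety G B b).hom :=
    inferInstanceAs (LocallyOfFiniteType
      ((graphIdeal G B b).subschemeι ≫ (multiProjectiveSpace K V n).hom))
  have : IsNoetherianRing (CommRingCat.of K) := inferInstanceAs (IsNoetherianRing K)
  exact smooth_of_iSup_eq_top _ hT
    (top_le_iff.1 fun x _ => TopologicalSpace.Opens.mem_iSup.2 ⟨x, hxT x⟩)
    fun x θ hθ => formallySmooth_of_isAcyclic B b G hG hAlt hB (T x) (i x) (hi x) (hT x) θ.hom hθ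

/-- The solution modulo `I` is a point of the variety; over a local ring it lies in a single affine
open, whose coordinate ring is formally smooth over `K`, so it lifts. -/
theorem exists_lift_of_smooth [IsLocalRing A] (hs : Smooth (projectiveGraphVariety G B b).hom)
    {I : Ideal A} (hI : I ^ 2 = ⊥) (w₀ : V → Fin n → A) (i : V → Fin n) (hw₀ : ∀ v, w₀ v (i v) = 1)
    (h₀ : ∀ v v', G.Adj v v' → pairing B b (w₀ v) (w₀ v') ∈ I) :
    ∃ w : V → Fin n → A, (∀ v a, w v a - w₀ v a ∈ I) ∧
      ∀ v v', G.Adj v v' → pairing B b (w v) (w v') = 0 := by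
  have hItop : I ≠ ⊤ := by
    rintro rfl
    rw [Ideal.top_pow] at hI
    exact top_ne_bot hI
  have : Nontrivial (A ⧸ I) := Ideal.Quotient.nontrivial_iff.2 hItop
  have : IsLocalRing (A ⧸ I) := .of_surjective' (Ideal.Quotient.mk I) Ideal.Quotient.mk_surjective
  let w' : V → Fin n → A ⧸ I := fun v a => Ideal.Quotient.mkₐ K I (w₀ v a)
  have hw' (v : V) : w' v (i v) = 1 := by simp [w', hw₀]
  have hw'G (v v' : V) (h : G.Adj v v') : pairing B b (w' v) (w' v') = 0 := by
    rw [← map_pairing]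
    exact Ideal.Quotient.eq_zero_iff_mem.2 (h₀ v v' h)
  let g : Spec (.of (A ⧸ I)) ⟶ (graphIdeal G B b).subscheme :=
    IsClosedImmersion.lift (graphIdeal G B b).subschemeι
      (multiPoint K w' i fun v => hw' v ▸ isUnit_one)
      ((graphIdeal G B b).ker_subschemeι.trans_le (graphIdeal_le_ker B b G w' i _ hw'G))
  have hgw' : g ≫ (graphIdeal G B b).subschemeι =
      multiPoint K w' i fun v => hw' v ▸ isUnit_one := IsClosedImmersion.lift_fac _ _ _
  -- An open set containing the image of the closed point contains the whole image. The charts `j`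
  -- around `T` may differ from the normalizing charts `i`.
  obtain ⟨T, hT, hxT, j, hj⟩ := exists_preimage_affineOpen B b G
    (g (IsLocalRing.closedPoint (A ⧸ I)))
  have hgT : ⊤ ≤ g ⁻¹ᵁ ((graphIdeal G B b).subschemeι ⁻¹ᵁ T.1) := by
    refine top_le_iff.2 ((IsLocalRing.closedPoint_mem_iff (R := A ⧸ I) _).1 hxT)
  obtain ⟨θ, hθ⟩ := Spec.map_surjective (hT.fromSpec ≫ (projectiveGraphVariety G B b).hom)
  have hθ' : Spec.map θ = hT.fromSpec ≫ (graphIdeal G B b).subschemeι ≫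
    (multiProjectiveSpace K V n).hom := hθ
  have hθs : θ.hom.FormallySmooth := (smooth_of_SpecMap_eq hs hT hθ).formallySmooth
  let _ := θ.hom.toAlgebra
  have hθs' : Algebra.FormallySmooth K
    Γ((graphIdeal G B b).subscheme, (graphIdeal G B b).subschemeι ⁻¹ᵁ T.1) := hθs
  obtain ⟨ρ', hρ'⟩ := exists_eq_SpecMap_fromSpec hT g hgT
  have hρ'K (r : K) : ρ' (θ.hom r) = algebraMap K (A ⧸ I) r := by
    have h1 : g ≫ (graphIdeal G B b).subschemeι ≫ (multiProjectiveSpace K V n).hom =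
        Spec.map (CommRingCat.ofHom (algebraMap K (A ⧸ I))) := by
      rw [← Category.assoc, hgw', multiPoint_comp_hom]
    rw [hρ', Category.assoc, ← hθ', ← Spec.map_comp, Spec.map_inj] at h1
    exact congr($(h1).hom r)
  obtain ⟨ρ, hρ⟩ := Algebra.FormallySmooth.comp_surjective K _ I hI { ρ' with commutes' := hρ'K }
  let h : Spec (.of A) ⟶ (graphIdeal G B b).subscheme :=
    Spec.map (CommRingCat.ofHom ρ.toRingHom) ≫ hT.fromSpec
  have hhg : Spec.map (CommRingCat.ofHom (Ideal.Quotient.mk I)) ≫ h = g := by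
    rw [hρ', ← Category.assoc, ← Spec.map_comp, ← CommRingCat.ofHom_comp]
    congr 3
    exact RingHom.ext fun r => DFunLike.congr_fun hρ r
  have hhT := top_le_preimage_of_SpecMap_mk hI h _ (hhg ▸ hgT)
  have hhK : (h ≫ (graphIdeal G B b).subschemeι) ≫ (multiProjectiveSpace K V n).hom =
      Spec.map (CommRingCat.ofHom (algebraMap K A)) := by
    rw [Category.assoc, Category.assoc, ← hθ', ← CommRingCat.ofHom_hom θ, ← Spec.map_comp,
      ← CommRingCat.ofHom_comp]
    congr 2
    exact ρ.comp_algebraMap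
  obtain ⟨w, hw, hhw⟩ := exists_eq_multiPoint _ hhK i fun v => by
    refine top_le_preimage_of_SpecMap_mk hI _ _ ?_
    rw [← Category.assoc, hhg, hgw', ← Scheme.Hom.comp_preimage, multiPoint_proj]
    exact chart_le_preimage_point _ _ _
  refine ⟨w, fun v a => ?_, fun v v' hvv' => ?_⟩
  · have h1 := SpecMap_multiPoint (Ideal.Quotient.mkₐ K I) w i (fun v => hw v ▸ isUnit_one)
      fun v => by rw [hw, map_one]; exact isUnit_one
    rw [← hhw] at h1
    have h2 := (h1.symm.trans ((Category.assoc _ _ _).symm.trans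
      (congrArg (· ≫ (graphIdeal G B b).subschemeι) hhg))).trans hgw'
    -- Both coordinate families are normalized in the charts `i`, so equal points have equal
    -- coordinates.
    have h3 := multiPoint_injective (K := K) _ w' i (fun v => by rw [hw, map_one]) hw' h2
    exact Ideal.Quotient.eq.1 congr($h3 v a)
  · refine pairing_eq_zero_of_graphIdeal_le_ker B b G w i (fun v => hw v ▸ isUnit_one) ?_ T ?_ j hj
      hvv'
    · rw [← hhw]; exact graphIdeal_le_ker_comp B b G h
    · rw [← hhw]; exact hhT

end GraphVariety

/-! ### Smoothness excludes cycles -/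

namespace GraphVariety

theorem exists_isLocalRing_pow_three_eq_zero (K : Type u) [Field K] :
    ∃ (A : Type u) (_ : CommRing A) (_ : Algebra K A) (_ : IsLocalRing A) (t : A),
      t ^ 3 = 0 ∧ t ^ 2 ≠ 0 := by
  -- Power series are used because they already form a local ring, and so does any nontrivial
  -- quotient.
  let I : Ideal (PowerSeries K) := Ideal.span {PowerSeries.X ^ 3}
  have h2 : Ideal.Quotient.mk I PowerSeries.X ^ 2 ≠ 0 := by
    rw [← map_pow, Ne, Ideal.Quotient.eq_zero_iff_mem, Ideal.mem_span_singleton,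
      PowerSeries.X_pow_dvd_iff]
    intro h
    simpa using h 2 (by norm_num)
  have : Nontrivial (PowerSeries K ⧸ I) := ⟨_, _, h2⟩
  refine ⟨PowerSeries K ⧸ I, inferInstance, inferInstance,
    .of_surjective' (Ideal.Quotient.mk I) Ideal.Quotient.mk_surjective,
    Ideal.Quotient.mk I PowerSeries.X, ?_, h2⟩
  rw [← map_pow, Ideal.Quotient.eq_zero_iff_mem]
  exact Ideal.mem_span_singleton_self _

theorem isAcyclic_of_smooth {K : Type u} [Field K] {n : ℕ} {V : Type*} [Finite V] {W : Type*}
    [AddCommGroup W] [Module K W] (B : LinearMap.BilinForm K W) (b : Module.Basis (Fin n) K W)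
    (G : SimpleGraph V) (hAlt : B.IsAlt) (hB : B.Nondegenerate) (hn : 3 ≤ n)
    (hs : Smooth (projectiveGraphVariety G B b).hom) : G.IsAcyclic := by
  by_contra hG
  obtain ⟨A, _, _, _, t, ht, ht'⟩ := exists_isLocalRing_pow_three_eq_zero K
  obtain ⟨w₀, i, hw₀, h₀, hno⟩ := exists_not_liftable B b hG hAlt hB hn ht ht'
  refine hno (exists_lift_of_smooth B b G hs ?_ w₀ i hw₀ h₀)
  rw [Ideal.span_singleton_pow, Ideal.span_singleton_eq_bot]
  linear_combination t * ht

end GraphVariety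

end

theorem theoremB {K : Type u} [Field K] {V : Type*} [Fintype V] (G : SimpleGraph V)
    [DecidableRel G.Adj] {W : Type*} [AddCommGroup W] [Module K W] {n : ℕ}
    (b : Module.Basis (Fin n) K W) (B : LinearMap.BilinForm K W)
    (hAlt : B.IsAlt) (hNondeg : B.Nondegenerate)
    (d : ℕ) (hd : G.IsDegenerate d)
    (hdim : d + G.maxDegree ≤ Module.finrank K W + 1) :
    AlgebraicGeometry.Smooth (GraphVariety.projectiveGraphVariety G B b).hom ↔ G.IsAcyclic := by
  refine ⟨fun hs => ?_, fun hG => GraphVariety.smooth_of_isAcyclic B b G hG hAlt hNondeg⟩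
  by_contra hG
  -- With `2 ≤ d` and `2 ≤ G.maxDegree`, the dimension bound becomes `3 ≤ n`.
  have h1 := hd.two_le hG
  have h2 := SimpleGraph.two_le_maxDegree hG
  rw [Module.finrank_eq_card_basis b, Fintype.card_fin] at hdim
  exact hG (GraphVariety.isAcyclic_of_smooth B b G hAlt hNondeg (by omega) hs)
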